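/- **Setting.** Let $I$ be a set and, for $i\in I$, let $\mathcal A_i$ be a unital algebra over $\mathbb C$ with a linear functional $\varphi_i$ such that $\varphi_i(1)=1$. Let $N\ge 1$ and $\epsilon>0$, and let $\varphi_{i,t}$ ($i\in I$, $t\in(-\epsilon,\epsilon)$) be linear functionals on $\mathcal A_i$ with $\varphi_{i,t}(1)=1$ and, elementwise as $t\to0$, $$\varphi_{i,t}=\varphi_i+t\varphi_i^{(1)}+\cdots+\tfrac{t^N}{N!}\varphi_i^{(N)}+o(t^N),\qquad \varphi_{i,0}=\varphi_i,$$ where the $\varphi_i^{(k)}$ are linear functionals with $\varphi_i^{(k)}(1)=0$; write $\varphi_i'=\varphi_i^{(1)}$. *Motzkin functionals.* Let $\widetilde{\mathcal A}_i=\mathcal A_i\star\mathrm{alg}(p_i)$ be the free product, with identified units, of $\mathcal A_i$ and the unital algebra generated by an idempotent $p_i$, and let $\widetilde\varphi_{i,t}$ be the linear functional on it with $\widetilde\varphi_{i,t}(p_i^{\alpha}b_1p_ib_2p_i\cdots p_ib_rp_i^{\beta})=\varphi_{i,t}(b_1)\cdots\varphi_{i,t}(b_r)$ for $b_1,\dots,b_r\in\mathcal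 A_i$, $\alpha,\beta\in\{0,1\}$. In $\mathcal A_\otimes=\bigotimes_{i\in I}\widetilde{\mathcal A}_i^{\otimes\infty}$, whose tensor sites are the pairs $(i,j)$ with $i\in I$, $j\in\{1,2,\dots\}$, let $P_{i,j}$ be the simple tensor with $p_{i'}$ at all sites $(i',j')$ with $i'\ne i$, $j'\ge j$ and units elsewhere ($j\ge1$), and put $P_{i,0}=0$. For $a\in\mathcal A_i$ let $a(j)=(a)_{i,j}\,(P_{i,j}-P_{i,j-1})$, where $(a)_{i,j}$ has $a$ at the site $(i,j)$ and units elsewhere. For a word $w=j_1\cdots j_n$ and $a_k\in\mathcal A_{i_k}$ put $$\Phi_{w,t}(a_1,\dots,a_n)=\Big(\bigotimes_{i\in I}\widetilde\varphi_{i,t}^{\otimes\infty}\Big)\big(a_1(j_1)\cdots a_n(j_n)\big),\qquad \Phi_w'(a_1,\dots,a_n)=\frac{d}{dt}\Phi_{w,t}(a_1,\dots,a_n)\Big|_{t=0}.$$ *Words.* $\mathcal M_n$ ($n\ge1$) is the set of reduced Motzkin words $w=j_1\cdots j_n$: $j_k\in\{1,2,\dots\}$, $j_1=j_n=1$ and $j_k-j_{k-1}\in\{-1,0,1\}$.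 A *level return block* of $w$ of color $j$ is a nonempty set $V$ of consecutive elements of $\{k: j_k=j\}$ such that any two consecutive elements $p<q$ of $V$ satisfy $q-p>1$ and $j_r>j$ for all $p<r<q$; $\pi(w)$ consists, for all colors $j$, of the level return blocks of color $j$ that are maximal among those of color $j$. The word $w$ is *adapted* to $(i_1,\dots,i_n)$ if (a) $i_p=i_q$ whenever $p,q$ lie in the same block of $\pi(w)$; (b) whenever $p<q$ are consecutive elements of a block $V\in\pi(w)$ of color $j$ and $V'\in\pi(w)$ is a block of color $j+1$ contained in $\{p+1,\dots,q-1\}$, then $i_r\neq i_{r'}$ for all $r\in V$, $r'\in V'$. The *pyramid words* are $1\,2\cdots(m-1)\,m\,(m-1)\cdots2\,1$, of length $2m-1$, $m\ge1$. **Lemma 7.2.** Let $a_k\in\mathcal A_{i_k}$ with $\varphi_{i_k}(a_k)=0$ for $k=1,\dots,n$, where $i_1\ne i_2\ne\cdots\ne i_n$ (neighboring labels differ), and let $w\in\mathcal M_n$, $n\ge1$. Then $t\mapsto\Phi_{w,t}(a_1,\dots,a_n)$ is differentiable at $0$, and: 1. If $w=1\cdots(m-1)m(m-1)\cdots1$ is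 a pyramid word (so $n=2m-1$) and $w$ is adapted to $(i_1,\dots,i_n)$, then $$\Phi_w'(a_1,\dots,a_n)=\varphi_{i_1}(a_1a_n)\,\varphi_{i_2}(a_2a_{n-1})\cdots\varphi_{i_{m-1}}(a_{m-1}a_{m+1})\,\varphi_{i_m}'(a_m).$$ 2. In the remaining cases ($w$ is not a pyramid word, or $w$ is not adapted to $(i_1,\dots,i_n)$), $\Phi_w'(a_1,\dots,a_n)=0$. -/

import Mathlib

open scoped BigOperators Topology TensorProduct

noncomputable section

namespace InfMotzkin

/-! ### Boolean extensions -/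

section BooleanExtension

variable (A : Type*) [Ring A] [Algebra ℂ A]

/-- Defining relations of the unital algebra generated by a copy of the unital algebra `A`
(letters `some a`) and an idempotent `p` (the letter `none`). -/
inductive BoolRel : FreeAlgebra ℂ (Option A) → FreeAlgebra ℂ (Option A) → Prop
  | add (a b : A) : BoolRel (FreeAlgebra.ι ℂ (some (a + b)))
      (FreeAlgebra.ι ℂ (some a) + FreeAlgebra.ι ℂ (some b))
  | mul (a b : A) : BoolRel (FreeAlgebra.ι ℂ (some (a * b)))
      (FreeAlgebra.ι ℂ (some a) * FreeAlgebra.ι ℂ (some b))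
  | scalar (c : ℂ) : BoolRel (FreeAlgebra.ι ℂ (some (algebraMap ℂ A c)))
      (algebraMap ℂ (FreeAlgebra ℂ (Option A)) c)
  | idem : BoolRel (FreeAlgebra.ι ℂ none * FreeAlgebra.ι ℂ none) (FreeAlgebra.ι ℂ none)

/-- The algebra `Ã = A ⋆ alg(p)`: the free product, with identified units, of `A` and the
unital algebra generated by an idempotent `p`. -/
def BoolExt : Type _ := RingQuot (BoolRel A)

instance : Ring (BoolExt A) := inferInstanceAs (Ring (RingQuot (BoolRel A)))

instance : Algebra ℂ (BoolExt A) := inferInstanceAs (Algebra ℂ (RingQuot (BoolRel A)))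

/-- The quotient map from the free algebra onto `Ã`. -/
def BoolExt.mk : FreeAlgebra ℂ (Option A) →ₐ[ℂ] BoolExt A := RingQuot.mkAlgHom ℂ (BoolRel A)

theorem BoolExt.mk_rel {x y : FreeAlgebra ℂ (Option A)} (h : BoolRel A x y) :
    BoolExt.mk A x = BoolExt.mk A y := RingQuot.mkAlgHom_rel ℂ h

variable {A}

/-- The unital embedding `A → Ã`. -/
def BoolExt.incl : A →ₐ[ℂ] BoolExt A :=
  AlgHom.ofLinearMap
    { toFun := fun a => BoolExt.mk A (FreeAlgebra.ι ℂ (some a))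
      map_add' := fun a b => by
        rw [BoolExt.mk_rel A (BoolRel.add a b), map_add]
      map_smul' := fun c a => by
        rw [Algebra.smul_def, BoolExt.mk_rel A (BoolRel.mul _ _), map_mul,
          BoolExt.mk_rel A (BoolRel.scalar c), AlgHom.commutes, RingHom.id_apply,
          Algebra.smul_def] }
    (by
      have h := BoolExt.mk_rel A (BoolRel.scalar (A := A) 1)
      simpa using h)
    (fun a b => by
      have h := BoolExt.mk_rel A (BoolRel.mul a b)
      simpa using h)

variable (A) in
/-- The adjoined idempotent `p ∈ Ã`. -/
def BoolExt.p : BoolExt A := BoolExt.mk A (FreeAlgebra.ι ℂ none)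

theorem BoolExt.p_mul_p : BoolExt.p A * BoolExt.p A = BoolExt.p A := by
  have h := BoolExt.mk_rel A (BoolRel.idem (A := A))
  simpa [BoolExt.p] using h

theorem boolAction_aux (φ : A →ₗ[ℂ] ℂ) (h : φ 1 = 1) ⦃x y : FreeAlgebra ℂ (Option A)⦄
    (hxy : BoolRel A x y) :
    FreeAlgebra.lift ℂ (fun x : Option A =>
      x.elim (φ.smulRight (1 : A)) (fun a => LinearMap.mulLeft ℂ a)) x =
    FreeAlgebra.lift ℂ (fun x : Option A =>
      x.elim (φ.smulRight (1 : A)) (fun a => LinearMap.mulLeft ℂ a)) y := by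
  induction hxy with
  | add a b => ext c; simp [add_mul]
  | mul a b => ext c; simp
  | scalar r => ext c; simp [Algebra.smul_def]
  | idem => ext c; simp [h]

/-- For a normalized functional `φ`, the action of `Ã` on the vector space `A` in which `a ∈ A`
acts by left multiplication and `p` acts as the rank one idempotent `b ↦ φ(b) 1`. -/
def boolAction (φ : A →ₗ[ℂ] ℂ) (h : φ 1 = 1) : BoolExt A →ₐ[ℂ] Module.End ℂ A :=
  RingQuot.liftAlgHom ℂ ⟨FreeAlgebra.lift ℂ (fun x : Option A =>
      x.elim (φ.smulRight (1 : A)) (fun a => LinearMap.mulLeft ℂ a)), boolAction_aux φ h⟩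

theorem boolAction_mk (φ : A →ₗ[ℂ] ℂ) (h : φ 1 = 1) (x : FreeAlgebra ℂ (Option A)) :
    boolAction φ h (BoolExt.mk A x) = FreeAlgebra.lift ℂ (fun x : Option A =>
      x.elim (φ.smulRight (1 : A)) (fun a => LinearMap.mulLeft ℂ a)) x :=
  RingQuot.liftAlgHom_mkAlgHom_apply ℂ _ (boolAction_aux φ h) x

open Classical in
/-- The Boolean extension `φ̃` of a normalized linear functional `φ`, that is, the linear
functional on `Ã = A ⋆ alg(p)` with
`φ̃(p^α a₁ p a₂ p ⋯ p aₙ p^β) = φ(a₁) ⋯ φ(aₙ)` for `α, β ∈ {0,1}`, which is characterized by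
`boolFunctional_incl`, `boolFunctional_p`, `boolFunctional_mul_p_mul` below.
The notion makes sense only if `φ(1) = 1`; the value `0` is used otherwise. -/
def boolFunctional (φ : A →ₗ[ℂ] ℂ) : BoolExt A →ₗ[ℂ] ℂ :=
  if h : φ 1 = 1 then φ ∘ₗ LinearMap.applyₗ (1 : A) ∘ₗ (boolAction φ h).toLinearMap else 0

theorem boolAction_incl (φ : A →ₗ[ℂ] ℂ) (h : φ 1 = 1) (a b : A) :
    boolAction φ h (BoolExt.incl a) b = a * b := by
  simp [BoolExt.incl, boolAction_mk]

theorem boolAction_p (φ : A →ₗ[ℂ] ℂ) (h : φ 1 = 1) (b : A) :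
    boolAction φ h (BoolExt.p A) b = φ b • (1 : A) := by
  simp [BoolExt.p, boolAction_mk]

theorem boolFunctional_incl (φ : A →ₗ[ℂ] ℂ) (h : φ 1 = 1) (a : A) :
    boolFunctional φ (BoolExt.incl a) = φ a := by
  simp [boolFunctional, h, boolAction_incl]

theorem boolFunctional_p (φ : A →ₗ[ℂ] ℂ) (h : φ 1 = 1) :
    boolFunctional φ (BoolExt.p A) = 1 := by
  simp [boolFunctional, h, boolAction_p]

theorem boolFunctional_mul_p_mul (φ : A →ₗ[ℂ] ℂ) (h : φ 1 = 1) (x y : BoolExt A) :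
    boolFunctional φ (x * BoolExt.p A * y) = boolFunctional φ x * boolFunctional φ y := by
  simp [boolFunctional, h, boolAction_p, mul_comm]

end BooleanExtension

/-! ### Infinite products of functionals -/

section ProductFunctional

variable {S : Type*} {B : S → Type*} [∀ s, Ring (B s)] [∀ s, Algebra ℂ (B s)]

theorem finite_update_iff [DecidableEq S] (f : ∀ s, B s →ₗ[ℂ] ℂ) (x : ∀ s, B s) (s : S)
    (v : B s) :
    {r | f r (Function.update x s v r) ≠ 1}.Finite ↔ {r | r ≠ s ∧ f r (x r) ≠ 1}.Finite := by
  constructor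
  · intro h
    refine h.subset ?_
    rintro r ⟨hr, h1⟩
    simpa [Function.update_of_ne hr] using h1
  · intro h
    refine (h.insert s).subset ?_
    intro r hr
    by_cases hrs : r = s
    · exact Or.inl hrs
    · refine Or.inr ⟨hrs, ?_⟩
      simpa [Function.update_of_ne hrs] using hr

theorem finprod_update [DecidableEq S] (f : ∀ s, B s →ₗ[ℂ] ℂ) (x : ∀ s, B s) (s : S)
    (v : B s)
    (h : {r | r ≠ s ∧ f r (x r) ≠ 1}.Finite) :
    ∏ᶠ r, f r (Function.update x s v r) = f s v * ∏ᶠ r, (if r = s then 1 else f r (x r)) := by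
  have hg : (fun r => f r (Function.update x s v r)) =
      fun r => (if r = s then f s v else 1) * (if r = s then 1 else f r (x r)) := by
    funext r
    by_cases hr : r = s
    · subst hr; simp
    · simp [hr]
  rw [hg, finprod_mul_distrib]
  · congr 1
    exact finprod_eq_single (fun r => if r = s then f s v else 1) s (fun r hr => by simp [hr])
      |>.trans (by simp)
  · refine (Set.finite_singleton s).subset ?_
    intro r hr
    by_contra hrs
    have hrs' : r ≠ s := hrs
    exact hr (by simp [hrs'])
  · refine h.subset ?_
    intro r hr
    by_cases hrs : r = s
    · exact absurd (by simp [hrs]) hr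
    · exact ⟨hrs, by simpa [hrs] using hr⟩

open Classical in
/-- The multilinear map `(x_s) ↦ ∏ f_s(x_s)` on families, the product being meaningful when all but
finitely many factors are `1`. Families for which infinitely many factors differ from `1`
(they do not occur in the algebra generated by orthogonal replicas) are sent to `0`; as altering
one entry of a family does not affect which case applies, this is multilinear. -/
def productMultilinear (f : ∀ s, B s →ₗ[ℂ] ℂ) : MultilinearMap ℂ B ℂ where
  toFun x := if {s | f s (x s) ≠ 1}.Finite then ∏ᶠ s, f s (x s) else 0
  map_update_add' := by
    intro _ x s y z
    have hfin : ∀ v, {r | f r (Function.update x s v r) ≠ 1}.Finite ↔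
        {r | r ≠ s ∧ f r (x r) ≠ 1}.Finite := finite_update_iff f x s
    by_cases h : {r | r ≠ s ∧ f r (x r) ≠ 1}.Finite
    · rw [if_pos ((hfin _).2 h), if_pos ((hfin _).2 h), if_pos ((hfin _).2 h),
        finprod_update f x s _ h, finprod_update f x s _ h, finprod_update f x s _ h,
        map_add, add_mul]
    · rw [if_neg (mt (hfin _).1 h), if_neg (mt (hfin _).1 h), if_neg (mt (hfin _).1 h), add_zero]
  map_update_smul' := by
    intro _ x s c y
    have hfin : ∀ v, {r | f r (Function.update x s v r) ≠ 1}.Finite ↔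
        {r | r ≠ s ∧ f r (x r) ≠ 1}.Finite := finite_update_iff f x s
    by_cases h : {r | r ≠ s ∧ f r (x r) ≠ 1}.Finite
    · rw [if_pos ((hfin _).2 h), if_pos ((hfin _).2 h),
        finprod_update f x s _ h, finprod_update f x s _ h,
        map_smul, smul_eq_mul, smul_eq_mul, mul_assoc]
    · rw [if_neg (mt (hfin _).1 h), if_neg (mt (hfin _).1 h), smul_zero]

/-- The tensor product functional `⨂ f_s` on the tensor product `⨂ B_s` of algebras:
`⨂ x_s ↦ ∏ f_s(x_s)` whenever all but finitely many of the factors are `1`. -/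
def productFunctional (f : ∀ s, B s →ₗ[ℂ] ℂ) : (⨂[ℂ] s, B s) →ₗ[ℂ] ℂ :=
  PiTensorProduct.lift (productMultilinear f)

end ProductFunctional

/-! ### Orthogonal replicas and Motzkin functionals -/

section Replicas

variable {I : Type*} {A : I → Type*} [∀ i, Ring (A i)] [∀ i, Algebra ℂ (A i)]

variable (A) in
/-- `A_⊗ = ⨂_{i ∈ I} Ã_i^{⊗ ∞}`: one copy of `Ã_i` at each site `(i, j)` of label `i ∈ I` and
color `j ∈ {1, 2, 3, …}`. -/
abbrev TensorAlg : Type _ := ⨂[ℂ] s : I × ℕ+, BoolExt (A s.1)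

open Classical in
variable (A) in
/-- `P_{i,j}`: the simple tensor with the idempotent `p` at all sites `(i', j')` with `i' ≠ i` and
`j' ≥ j`, and units elsewhere, for `j ≥ 1`. The term `P_{i,0}` is omitted, i.e. `P_{i,0} = 0`. -/
def P (i : I) (j : ℕ) : TensorAlg A :=
  if j = 0 then 0 else
    PiTensorProduct.tprod ℂ (fun s : I × ℕ+ =>
      if s.1 ≠ i ∧ j ≤ (s.2 : ℕ) then BoolExt.p (A s.1) else 1)

open Classical in
/-- The orthogonal replica `a(j) = (a)_{i,j} ⊗ (P_{i,j} - P_{i,j-1})` of `a ∈ A_i` of color `j`,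
as a linear function of `a`. -/
def replica (i : I) (j : ℕ+) : A i →ₗ[ℂ] TensorAlg A :=
  LinearMap.mulRight ℂ (P A i (j : ℕ) - P A i ((j : ℕ) - 1)) ∘ₗ
    (PiTensorProduct.singleAlgHom (R := ℂ) (A := fun s : I × ℕ+ => BoolExt (A s.1))
      (i, j)).toLinearMap ∘ₗ (BoolExt.incl (A := A i)).toLinearMap

/-- `Φ_⊗ = ⨂_{i ∈ I} φ̃_i^{⊗ ∞}`. -/
def tensorFunctional (φ : ∀ i, A i →ₗ[ℂ] ℂ) : TensorAlg A →ₗ[ℂ] ℂ :=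
  productFunctional (fun s : I × ℕ+ => boolFunctional (φ s.1))

/-- The Motzkin functional `Φ_w(a₁, …, aₙ) = Φ_⊗(a₁(j₁) ⋯ aₙ(jₙ))` for the word `w = j₁ ⋯ jₙ` and
`a_k ∈ A_{i_k}`. -/
def motzkinFunctional (φ : ∀ i, A i →ₗ[ℂ] ℂ) {n : ℕ} (w : Fin n → ℕ+) (i : Fin n → I) :
    MultilinearMap ℂ (fun k => A (i k)) ℂ :=
  (tensorFunctional φ).compMultilinearMap
    ((MultilinearMap.mkPiAlgebraFin ℂ n (TensorAlg A)).compLinearMap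
      (fun k => replica (i k) (w k)))

/-- A deformation of order `m` of a family `(φ_i)` of normalized functionals: normalized
functionals `φ_{i,t}`, `t ∈ (-ε, ε)`, and functionals `φ_i^{(k)}`, `1 ≤ k ≤ m`, vanishing at `1`,
such that
`φ_{i,t} = φ_i + t φ_i^{(1)} + ⋯ + (t^m / m!) φ_i^{(m)} + o(t^m)` as `t → 0`, elementwise. (At
`t = 0` the error term is `0`, so that `φ_{i,0} = φ_i`.) Values of `functional` at `|t| ≥ ε` and of
`coeff` outside `1 ≤ k ≤ m` are irrelevant. -/
structure Deformation (φ : ∀ i, A i →ₗ[ℂ] ℂ) (m : ℕ) where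
  /-- the bound on the parameter -/
  ε : ℝ
  ε_pos : 0 < ε
  /-- `φ_{i,t}` -/
  functional : ℝ → ∀ i, A i →ₗ[ℂ] ℂ
  /-- `φ_i^{(k)}` -/
  coeff : ℕ → ∀ i, A i →ₗ[ℂ] ℂ
  functional_one : ∀ t ∈ Set.Ioo (-ε) ε, ∀ i, functional t i 1 = 1
  coeff_one : ∀ k ∈ Finset.Icc 1 m, ∀ i, coeff k i 1 = 0
  expansion : ∀ i (a : A i),
    (fun t : ℝ => functional t i a -
      (φ i a + ∑ k ∈ Finset.Icc 1 m, ((t : ℂ) ^ k / (k.factorial : ℂ)) * coeff k i a))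
      =o[𝓝 0] (fun t : ℝ => t ^ m)

/-- The deformed Motzkin functional `Φ_{w,t}`. -/
def Deformation.motzkin {φ : ∀ i, A i →ₗ[ℂ] ℂ} {m : ℕ} (D : Deformation φ m) {n : ℕ}
    (w : Fin n → ℕ+) (i : Fin n → I) (t : ℝ) : MultilinearMap ℂ (fun k => A (i k)) ℂ :=
  motzkinFunctional (D.functional t) w i

/-- The infinitesimal Motzkin functional `Φ'_w(a₁, …, aₙ) = d/dt Φ_{w,t}(a₁, …, aₙ)` at `t = 0`. -/
def Deformation.infMotzkin {φ : ∀ i, A i →ₗ[ℂ] ℂ} {m : ℕ} (D : Deformation φ m) {n : ℕ}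
    (w : Fin n → ℕ+) (i : Fin n → I) (a : ∀ k, A (i k)) : ℂ :=
  deriv (fun t : ℝ => D.motzkin w i t a) 0

open Classical in
/-- `φ_i(a b)` for two elements `a ∈ A_i`, `b ∈ A_{i'}` with `i' = i`. (It is used only for equal
labels; the value `0` is used otherwise.) -/
def pairMoment (φ : ∀ i, A i →ₗ[ℂ] ℂ) {i i' : I} (a : A i) (b : A i') : ℂ :=
  if h : i' = i then φ i (a * (h ▸ b)) else 0

end Replicas

/-! ### Motzkin words and level return partitions -/

section Words

variable {n : ℕ}

/-- Reduced Motzkin words `w = j₁ ⋯ jₙ` of length `n ≥ 1`. The position `k ∈ {1, …, n}` is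
`k - 1` in `Fin n`. -/
structure IsReducedMotzkin (w : Fin n → ℕ+) : Prop where
  pos : 0 < n
  first : ∀ k : Fin n, (k : ℕ) = 0 → w k = 1
  last : ∀ k : Fin n, (k : ℕ) + 1 = n → w k = 1
  step : ∀ k l : Fin n, (l : ℕ) = k + 1 →
    ((w l : ℕ) : ℤ) - ((w k : ℕ) : ℤ) ∈ ({-1, 0, 1} : Set ℤ)

/-- `w` is the pyramid word `1 2 ⋯ (m-1) m (m-1) ⋯ 2 1` of length `n = 2m - 1`, where `m ≥ 1`
(the word `1` if `m = 1`). -/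
def IsPyramid (m : ℕ) (w : Fin n → ℕ+) : Prop :=
  1 ≤ m ∧ n = 2 * m - 1 ∧
    ∀ k : Fin n, (w k : ℕ) = if (k : ℕ) + 1 ≤ m then (k : ℕ) + 1 else 2 * m - ((k : ℕ) + 1)

/-- `p < q` are consecutive elements of `V`. -/
def Consecutive (V : Finset (Fin n)) (p q : Fin n) : Prop :=
  p ∈ V ∧ q ∈ V ∧ p < q ∧ ∀ r ∈ V, ¬ (p < r ∧ r < q)

/-- Level return blocks of color `j`: nonempty sets of consecutive elements of
`S_j = {k : j_k = j}` satisfying the gap condition and the return condition. -/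
structure IsLevelReturnBlock (w : Fin n → ℕ+) (j : ℕ+) (V : Finset (Fin n)) : Prop where
  nonempty : V.Nonempty
  color : ∀ k ∈ V, w k = j
  interval : ∀ p ∈ V, ∀ q ∈ V, ∀ r, p < r → r < q → w r = j → r ∈ V
  gap : ∀ p q, Consecutive V p q → (p : ℕ) + 1 < q
  ret : ∀ p q, Consecutive V p q → ∀ r, p < r → r < q → j < w r

/-- `V` is a block of color `j` of the level return partition `π(w)`, i.e. a maximal level return
block of color `j`. -/
def IsBlock (w : Fin n → ℕ+) (j : ℕ+) (V : Finset (Fin n)) : Prop :=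
  Maximal (IsLevelReturnBlock w j) V

/-- Neighboring labels are different: `i₁ ≠ i₂ ≠ ⋯ ≠ iₙ`. -/
def Alternating {I : Type*} (i : Fin n → I) : Prop :=
  ∀ k l : Fin n, (l : ℕ) = k + 1 → i k ≠ i l

/-- The level return partition `π(w)` is adapted to the labels `(i₁, …, iₙ)`: labels are constant
on blocks, and the label of a block `V` of color `j` differs from that of each block of color
`j + 1` contained in the excursion between two consecutive elements `p, q` of `V`. -/
structure IsAdapted {I : Type*} (w : Fin n → ℕ+) (i : Fin n → I) : Prop where
  uniform : ∀ j V, IsBlock w j V → ∀ p ∈ V, ∀ q ∈ V, i p = i q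
  nested : ∀ j V, IsBlock w j V → ∀ p q, Consecutive V p q →
    ∀ V', IsBlock w (j + 1) V' → (∀ r ∈ V', p < r ∧ r < q) →
      ∀ r ∈ V, ∀ r' ∈ V', i r ≠ i r'

end Words

end InfMotzkin

end

open scoped BigOperators Topology TensorProduct

noncomputable section

namespace InfMotzkin

/-! ### Calculus modulo the left kernel of a product functional -/

section ProductFunctionalCongr

variable {S : Type*} {B : S → Type*} [∀ s, Ring (B s)] [∀ s, Algebra ℂ (B s)]

/-! Build the product of replicas from right to left on the vacuum, that is, modulo the left kernel
of `Φ_⊗` (`VacEq`), which left multiplication preserves. By `φ̃(x p y) = φ̃(x) φ̃(y)`, a projection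
`p` meeting a layer replaces it by its expectation, while `p` acts as `1` on the vacuum. Hence each
suffix of the product is either zero or a scalar `c` times a layered vector (`layerVec`): one
variable in each color up to the current one, all layers below the top being centered.

The difference `P_{i,j} - P_{i,j-1}` produces three moves, according to whether the color rises,
stays or falls when read from right to left. Rising centers the top layer and stacks a new one.
Staying splits off the expectation of the top and replaces the top. Falling splits off that
expectation and multiplies the new variable into the layer below. The last two moves give zero if
the label of the layer below is unsuitable.

Each `φ_{i,t}(a_k)` vanishes at `t = 0`. For a pyramid with palindromic labels the moment is exactly
a product of covariances of mirror pairs times the mean of the summit variable; only that mean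
vanishes at `0`, so the product rule gives the formula (`suffixProd_pyramid`). Any other word either
gives zero throughout or, once it leaves the pyramid shape, has already split off one vanishing
factor and carries a fresh variable of vanishing mean on top, so its moment vanishes to second order
(`exists_reduction`). -/

theorem productFunctional_tprod_congr (f : ∀ s, B s →ₗ[ℂ] ℂ) {x y : ∀ s, B s}
    (h : ∀ s, f s (x s) = f s (y s)) :
    productFunctional f (PiTensorProduct.tprod ℂ x) =
      productFunctional f (PiTensorProduct.tprod ℂ y) := by
  have hfin : {s | f s (x s) ≠ 1} = {s | f s (y s) ≠ 1} := by simp only [h]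
  simp only [productFunctional, PiTensorProduct.lift.tprod]
  classical
  exact if_congr (by rw [hfin]) (by simp only [h]) rfl

end ProductFunctionalCongr

section VacuumCalculus

variable {I : Type*} {A : I → Type*} [∀ i, Ring (A i)] [∀ i, Algebra ℂ (A i)]

theorem boolFunctional_one {B : Type*} [Ring B] [Algebra ℂ B] (φ : B →ₗ[ℂ] ℂ) (h : φ 1 = 1) :
    boolFunctional φ 1 = 1 := by
  have := boolFunctional_incl φ h 1
  rwa [map_one, h] at this

theorem boolFunctional_mul_p {B : Type*} [Ring B] [Algebra ℂ B] (φ : B →ₗ[ℂ] ℂ) (h : φ 1 = 1)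
    (x : BoolExt B) : boolFunctional φ (x * BoolExt.p B) = boolFunctional φ x := by
  have := boolFunctional_mul_p_mul φ h x 1
  rwa [mul_one, boolFunctional_one φ h, mul_one] at this

/-- Two tensors are identified if they differ by an element of the left kernel of `Φ_⊗`, that is,
if they define the same vector in the cyclic representation of `Φ_⊗`. -/
def VacEq (ψ : ∀ i, A i →ₗ[ℂ] ℂ) (y y' : TensorAlg A) : Prop :=
  ∀ X : TensorAlg A, tensorFunctional ψ (X * y) = tensorFunctional ψ (X * y')

namespace VacEq

variable {ψ : ∀ i, A i →ₗ[ℂ] ℂ} {y y' y'' z z' : TensorAlg A}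

theorem refl (y : TensorAlg A) : VacEq ψ y y := fun _ => rfl

theorem trans (h : VacEq ψ y y') (h' : VacEq ψ y' y'') : VacEq ψ y y'' :=
  fun X => (h X).trans (h' X)

theorem mul_left (h : VacEq ψ y y') (x : TensorAlg A) : VacEq ψ (x * y) (x * y') := fun X => by
  rw [← mul_assoc, ← mul_assoc, h]

theorem smul (h : VacEq ψ y y') (c : ℂ) : VacEq ψ (c • y) (c • y') := fun X => by
  rw [mul_smul_comm, mul_smul_comm, map_smul, map_smul, h]

theorem sub (h : VacEq ψ y y') (h' : VacEq ψ z z') : VacEq ψ (y - z) (y' - z') := fun X => by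
  rw [mul_sub, mul_sub, map_sub, map_sub, h, h']

theorem value (h : VacEq ψ y y') : tensorFunctional ψ y = tensorFunctional ψ y' := by
  simpa using h 1

end VacEq

/-- By linearity the left factor may be taken to be a simple tensor, and the comparison then takes
place site by site. -/
theorem vacEq_tprod (ψ : ∀ i, A i →ₗ[ℂ] ℂ) {y y' : ∀ s : I × ℕ+, BoolExt (A s.1)}
    (h : ∀ (s : I × ℕ+) (x : BoolExt (A s.1)),
      boolFunctional (ψ s.1) (x * y s) = boolFunctional (ψ s.1) (x * y' s)) :
    VacEq ψ (PiTensorProduct.tprod ℂ y) (PiTensorProduct.tprod ℂ y') := by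
  intro X
  induction X using PiTensorProduct.induction_on with
  | smul_tprod r x =>
    rw [smul_mul_assoc, smul_mul_assoc, PiTensorProduct.tprod_mul_tprod,
      PiTensorProduct.tprod_mul_tprod, map_smul, map_smul]
    congr 1
    exact productFunctional_tprod_congr _ fun s => h s (x s)
  | add X Y hX hY => rw [add_mul, add_mul, map_add, map_add, hX, hY]

open Classical in
/-- The tensor with `z` at the site `s` and units elsewhere. -/
def siteElt (s : I × ℕ+) : BoolExt (A s.1) →ₐ[ℂ] TensorAlg A :=
  PiTensorProduct.singleAlgHom (R := ℂ) (A := fun s : I × ℕ+ => BoolExt (A s.1)) s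

open Classical in
theorem siteElt_eq_tprod (s : I × ℕ+) (z : BoolExt (A s.1)) :
    siteElt s z = PiTensorProduct.tprod ℂ
      (Pi.mulSingle (M := fun s : I × ℕ+ => BoolExt (A s.1)) s z) := rfl

open Classical in
theorem P_eq_tprod (i : I) {j : ℕ} (hj : j ≠ 0) : P A i j =
    PiTensorProduct.tprod ℂ (fun s : I × ℕ+ =>
      if s.1 ≠ i ∧ j ≤ (s.2 : ℕ) then BoolExt.p (A s.1) else 1) := by
  rw [P, if_neg hj]

theorem P_zero (i : I) : P A i 0 = 0 := by rw [P, if_pos rfl]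

/-- Under `h`, the site `s` is one where `P_{i,j}` has a unit. -/
theorem P_commute_siteElt (i : I) (j : ℕ) (s : I × ℕ+) (z : BoolExt (A s.1))
    (h : s.1 = i ∨ (s.2 : ℕ) < j) : Commute (P A i j) (siteElt s z) := by
  classical
  by_cases hj : j = 0
  · rw [hj, P_zero]; exact Commute.zero_left _
  rw [P_eq_tprod i hj, siteElt_eq_tprod]
  refine Commute.tprod ?_
  rw [commute_iff_eq]
  funext r
  by_cases hr : r = s
  · subst hr
    rw [Pi.mul_apply, Pi.mul_apply, if_neg, one_mul, mul_one]
    rintro ⟨h1, h2⟩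
    rcases h with h | h
    · exact h1 h
    · omega
  · simp [Pi.mulSingle_eq_of_ne hr]

theorem P_vacEq_one {ψ : ∀ i, A i →ₗ[ℂ] ℂ} (hψ : ∀ i, ψ i 1 = 1) (i : I) {j : ℕ} (hj : j ≠ 0) :
    VacEq ψ (P A i j) 1 := by
  classical
  rw [P_eq_tprod i hj, PiTensorProduct.one_def]
  refine vacEq_tprod ψ fun s x => ?_
  split_ifs
  · rw [boolFunctional_mul_p _ (hψ _), Pi.one_apply, mul_one]
  · simp

/-- At the site `s` this is `φ̃(x p z) = φ̃(x) φ̃(z)`; the hypothesis `hy` says that nothing else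
occupies the site. -/
theorem P_mul_siteElt_mul_vacEq {ψ : ∀ i, A i →ₗ[ℂ] ℂ} (hψ : ∀ i, ψ i 1 = 1) (i : I) (j : ℕ)
    (s : I × ℕ+) (hi : s.1 ≠ i) (hj : j ≤ (s.2 : ℕ)) (z : BoolExt (A s.1))
    (y : ∀ s : I × ℕ+, BoolExt (A s.1)) (hy : y s = 1) :
    VacEq ψ (P A i j * (siteElt s z * PiTensorProduct.tprod ℂ y))
      (boolFunctional (ψ s.1) z • (P A i j * PiTensorProduct.tprod ℂ y)) := by
  classical
  by_cases hj0 : j = 0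
  · rw [hj0, P_zero, zero_mul, zero_mul, smul_zero]; exact VacEq.refl _
  rw [P_eq_tprod i hj0, siteElt_eq_tprod, PiTensorProduct.tprod_mul_tprod,
    PiTensorProduct.tprod_mul_tprod, PiTensorProduct.tprod_mul_tprod]
  set Y : ∀ s : I × ℕ+, BoolExt (A s.1) :=
    (fun s : I × ℕ+ => if s.1 ≠ i ∧ j ≤ (s.2 : ℕ) then BoolExt.p (A s.1) else 1) * y with hY
  have hYs : Y s = BoolExt.p (A s.1) := by
    rw [hY, Pi.mul_apply, if_pos ⟨hi, hj⟩, hy, mul_one]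
  -- The scalar is moved into the entry at `s`, so that the two sides can be compared sitewise.
  have hsm : boolFunctional (ψ s.1) z • PiTensorProduct.tprod ℂ Y =
      PiTensorProduct.tprod ℂ (Function.update Y s (boolFunctional (ψ s.1) z • Y s)) := by
    rw [MultilinearMap.map_update_smul, Function.update_eq_self]
  rw [hsm]
  refine vacEq_tprod ψ fun r x => ?_
  by_cases hr : r = s
  · subst hr
    rw [Function.update_self, hYs, mul_smul_comm, map_smul, boolFunctional_mul_p _ (hψ _),
      Pi.mul_apply, if_pos ⟨hi, hj⟩, Pi.mul_apply, Pi.mulSingle_eq_same, hy, mul_one,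
      ← mul_assoc, boolFunctional_mul_p_mul _ (hψ _), smul_eq_mul, mul_comm]
  · rw [Function.update_of_ne hr, hY, Pi.mul_apply, Pi.mul_apply, Pi.mul_apply,
      Pi.mulSingle_eq_of_ne hr, one_mul]

theorem replica_apply (i : I) (j : ℕ+) (a : A i) : replica i j a =
    siteElt (i, j) (BoolExt.incl a) * (P A i (j : ℕ) - P A i ((j : ℕ) - 1)) := rfl

/-! ### Layered vectors -/

/-- The tensor with the entry number `j`, counted from the end of the list, at color `j`. -/
def layerVec : List (Σ i, A i) → TensorAlg A
  | [] => 1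
  | s :: L => siteElt (s.1, L.length.succPNat) (BoolExt.incl s.2) * layerVec L

/-- Guarantees that the site of the next layer is still vacant. -/
theorem layerVec_eq_tprod (L : List (Σ i, A i)) :
    ∃ y : ∀ s : I × ℕ+, BoolExt (A s.1), layerVec L = PiTensorProduct.tprod ℂ y ∧
      ∀ s : I × ℕ+, L.length < (s.2 : ℕ) → y s = 1 := by
  classical
  induction L with
  | nil => exact ⟨1, rfl, fun _ _ => rfl⟩
  | cons s L ih =>
    obtain ⟨y, hy, h1⟩ := ih
    refine ⟨_, by rw [layerVec, hy, siteElt_eq_tprod, PiTensorProduct.tprod_mul_tprod], ?_⟩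
    intro r hr
    rw [List.length_cons] at hr
    rw [Pi.mul_apply, h1 r (by omega), mul_one, Pi.mulSingle_eq_of_ne]
    rintro rfl
    simp at hr

theorem P_mul_layerVec_of_length_lt {ψ : ∀ i, A i →ₗ[ℂ] ℂ} (hψ : ∀ i, ψ i 1 = 1) (i : I) {j : ℕ}
    (L : List (Σ i, A i)) (hj : L.length < j) : VacEq ψ (P A i j * layerVec L) (layerVec L) := by
  have hc : Commute (P A i j) (layerVec L) := by
    induction L with
    | nil => exact Commute.one_right _
    | cons s L ih =>
      rw [List.length_cons] at hj
      refine Commute.mul_right (P_commute_siteElt _ _ _ _ (Or.inr ?_)) (ih (by omega))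
      simpa using hj
  rw [hc.eq]
  simpa using (P_vacEq_one hψ i (j := j) (by omega)).mul_left (layerVec L)

theorem P_mul_layerVec_cons {ψ : ∀ i, A i →ₗ[ℂ] ℂ} (hψ : ∀ i, ψ i 1 = 1) (i : I) {j : ℕ}
    (s : Σ i, A i) (L : List (Σ i, A i)) (hj : j ≤ L.length + 1) (hs : s.1 ≠ i) :
    VacEq ψ (P A i j * layerVec (s :: L)) (ψ s.1 s.2 • (P A i j * layerVec L)) := by
  obtain ⟨y, hy, h1⟩ := layerVec_eq_tprod L
  have := P_mul_siteElt_mul_vacEq hψ i j (s.1, L.length.succPNat) hs (by simpa using hj)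
    (BoolExt.incl s.2) y (h1 _ (by simp))
  rwa [boolFunctional_incl _ (hψ _), ← hy] at this

theorem P_mul_layerVec_cons_centered {ψ : ∀ i, A i →ₗ[ℂ] ℂ} (hψ : ∀ i, ψ i 1 = 1) (i : I) {j : ℕ}
    (s : Σ i, A i) (L : List (Σ i, A i)) (hj : j ≤ L.length + 1) (hs : s.1 ≠ i)
    (h0 : ψ s.1 s.2 = 0) : VacEq ψ (P A i j * layerVec (s :: L)) 0 := by
  simpa [h0] using P_mul_layerVec_cons hψ i s L hj hs

theorem P_mul_layerVec_cons_self (i : I) (j : ℕ) (x : A i) (L : List (Σ i, A i)) :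
    P A i j * layerVec (⟨i, x⟩ :: L) =
      siteElt (i, L.length.succPNat) (BoolExt.incl x) * (P A i j * layerVec L) := by
  rw [layerVec, ← mul_assoc, (P_commute_siteElt i j _ _ (Or.inl rfl)).eq, mul_assoc]

theorem layerVec_sub (i : I) (x y : A i) (L : List (Σ i, A i)) :
    layerVec (⟨i, x - y⟩ :: L) = layerVec (⟨i, x⟩ :: L) - layerVec (⟨i, y⟩ :: L) := by
  simp [layerVec, sub_mul]

theorem layerVec_smul_one (i : I) (c : ℂ) (L : List (Σ i, A i)) :
    layerVec (⟨i, c • (1 : A i)⟩ :: L) = c • layerVec L := by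
  simp [layerVec]

/-! ### Action of a replica on a layered vector. -/

theorem replica_mul_one_vacEq {ψ : ∀ i, A i →ₗ[ℂ] ℂ} (hψ : ∀ i, ψ i 1 = 1)
    (i : I) {j : ℕ+} (hj : (j : ℕ) = 1) (a : A i) :
    VacEq ψ (replica i j a * 1) (layerVec [⟨i, a⟩]) := by
  obtain rfl : j = 1 := PNat.eq hj
  rw [replica_apply, PNat.one_coe, Nat.sub_self, P_zero, sub_zero, mul_one]
  exact (P_vacEq_one hψ i one_ne_zero).mul_left _

/-- `P_{i,j}` starts above all layers and acts trivially; `P_{i,j-1}` averages the top layer. Their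
difference centers it. -/
theorem replica_mul_layerVec_up {ψ : ∀ i, A i →ₗ[ℂ] ℂ} (hψ : ∀ i, ψ i 1 = 1)
    (i : I) {j : ℕ+} (a : A i) (s : Σ i, A i) (L : List (Σ i, A i))
    (hj : (j : ℕ) = L.length + 2) (hs : s.1 ≠ i) :
    VacEq ψ (replica i j a * layerVec (s :: L))
      (layerVec (⟨i, a⟩ :: ⟨s.1, s.2 - ψ s.1 s.2 • 1⟩ :: L)) := by
  have hj' : j = (L.length + 1).succPNat := PNat.eq (by simpa using hj)
  rw [replica_apply, mul_assoc, layerVec.eq_2 ⟨i, a⟩, List.length_cons, ← hj',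
    layerVec_sub, layerVec_smul_one, sub_mul]
  refine VacEq.mul_left (VacEq.sub ?_ ?_) _
  · exact P_mul_layerVec_of_length_lt hψ i _ (by simp [hj])
  · refine (P_mul_layerVec_cons hψ i s L (by omega) hs).trans (VacEq.smul ?_ _)
    exact P_mul_layerVec_of_length_lt hψ i _ (by omega)

/-- `P_{i,j}` averages only the top layer, whereas `P_{i,j-1}` also meets the centered layer below
and gives zero. -/
theorem replica_mul_layerVec_flat {ψ : ∀ i, A i →ₗ[ℂ] ℂ} (hψ : ∀ i, ψ i 1 = 1)
    (i : I) {j : ℕ+} (a : A i) (s : Σ i, A i) (L : List (Σ i, A i))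
    (hj : (j : ℕ) = L.length + 1) (hs : s.1 ≠ i)
    (hL : ∀ r ∈ L.head?, r.1 ≠ i ∧ ψ r.1 r.2 = 0) :
    VacEq ψ (replica i j a * layerVec (s :: L)) (ψ s.1 s.2 • layerVec (⟨i, a⟩ :: L)) := by
  have hj' : j = (L.length).succPNat := PNat.eq (by simpa using hj)
  rw [replica_apply, mul_assoc, layerVec.eq_2 ⟨i, a⟩ L, ← hj', sub_mul, ← mul_smul_comm]
  refine VacEq.mul_left ?_ _
  have h1 : VacEq ψ (P A i j * layerVec (s :: L)) (ψ s.1 s.2 • layerVec L) :=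
    (P_mul_layerVec_cons hψ i s L (by omega) hs).trans
      ((P_mul_layerVec_of_length_lt hψ i _ (by omega)).smul _)
  have h2 : VacEq ψ (P A i (j - 1) * layerVec (s :: L)) 0 := by
    refine (P_mul_layerVec_cons hψ i s L (by omega) hs).trans ?_
    cases L with
    -- Here `j = 1`, and the convention `P_{i,0} = 0` replaces the centering argument.
    | nil => simpa [hj, P_zero] using VacEq.refl _
    | cons r L =>
      obtain ⟨h3, h4⟩ := hL r (by simp)
      rw [List.length_cons] at hj
      simpa using (P_mul_layerVec_cons_centered hψ i (j := j - 1) r L (by omega) h3 h4).smul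
        (ψ s.1 s.2)
  simpa using h1.sub h2

/-- A layer of label `i` is invisible to `P_{i,j-1}`, so both projections have the same effect and
cancel. -/
theorem replica_mul_layerVec_flat_eq_zero {ψ : ∀ i, A i →ₗ[ℂ] ℂ} (hψ : ∀ i, ψ i 1 = 1)
    (i : I) {j : ℕ+} (a : A i) (s : Σ i, A i) (x : A i)
    (L : List (Σ i, A i)) (hj : (j : ℕ) = L.length + 2) (hs : s.1 ≠ i) :
    VacEq ψ (replica i j a * layerVec (s :: ⟨i, x⟩ :: L)) 0 := by
  rw [replica_apply, mul_assoc, sub_mul, ← mul_zero (siteElt _ _)]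
  refine VacEq.mul_left ?_ _
  have h1 : VacEq ψ (P A i j * layerVec (s :: ⟨i, x⟩ :: L))
      (ψ s.1 s.2 • layerVec (⟨i, x⟩ :: L)) :=
    (P_mul_layerVec_cons hψ i s _ (by simp [hj]) hs).trans
      ((P_mul_layerVec_of_length_lt hψ i _ (by simp [hj])).smul _)
  have h2 : VacEq ψ (P A i (j - 1) * layerVec (s :: ⟨i, x⟩ :: L))
      (ψ s.1 s.2 • layerVec (⟨i, x⟩ :: L)) := by
    refine (P_mul_layerVec_cons hψ i s _ (by simp [hj]) hs).trans (VacEq.smul ?_ _)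
    rw [P_mul_layerVec_cons_self]
    exact (P_mul_layerVec_of_length_lt hψ i _ (by omega)).mul_left _
  simpa using h1.sub h2

/-- Both projections average the top layer and commute past `x`, which has label `i`; only
`P_{i,j-1}` reaches the layer below `x`, and it annihilates it. What remains lets `a` multiply `x`
at their common site. -/
theorem replica_mul_layerVec_down {ψ : ∀ i, A i →ₗ[ℂ] ℂ} (hψ : ∀ i, ψ i 1 = 1)
    (i : I) {j : ℕ+} (a : A i) (s : Σ i, A i) (x : A i)
    (L : List (Σ i, A i)) (hj : (j : ℕ) = L.length + 1) (hs : s.1 ≠ i)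
    (hL : ∀ r ∈ L.head?, r.1 ≠ i ∧ ψ r.1 r.2 = 0) :
    VacEq ψ (replica i j a * layerVec (s :: ⟨i, x⟩ :: L))
      (ψ s.1 s.2 • layerVec (⟨i, a * x⟩ :: L)) := by
  have hj' : j = (L.length).succPNat := PNat.eq (by simpa using hj)
  rw [replica_apply, mul_assoc, layerVec.eq_2 ⟨i, a * x⟩ L, ← hj', sub_mul, map_mul, map_mul,
    mul_assoc, ← mul_smul_comm]
  refine VacEq.mul_left ?_ _
  have h1 : VacEq ψ (P A i j * layerVec (s :: ⟨i, x⟩ :: L))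
      (ψ s.1 s.2 • (siteElt (i, j) (BoolExt.incl x) * layerVec L)) := by
    refine (P_mul_layerVec_cons hψ i s _ (by simp [hj]) hs).trans (VacEq.smul ?_ _)
    rw [P_mul_layerVec_cons_self, ← hj']
    exact (P_mul_layerVec_of_length_lt hψ i _ (by omega)).mul_left _
  have h2 : VacEq ψ (P A i (j - 1) * layerVec (s :: ⟨i, x⟩ :: L)) 0 := by
    refine (P_mul_layerVec_cons hψ i s _ (by simp [hj]; omega) hs).trans ?_
    rw [P_mul_layerVec_cons_self]
    cases L with
    | nil => simpa [hj, P_zero] using VacEq.refl _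
    | cons r L =>
      obtain ⟨h3, h4⟩ := hL r (by simp)
      rw [List.length_cons] at hj
      simpa using ((P_mul_layerVec_cons_centered hψ i (j := j - 1) r L (by omega) h3
        h4).mul_left _).smul (ψ s.1 s.2)
  simpa using h1.sub h2

/-- Both projections average the centered layer `r`, whose label is foreign to `i`. -/
theorem replica_mul_layerVec_down_eq_zero {ψ : ∀ i, A i →ₗ[ℂ] ℂ} (hψ : ∀ i, ψ i 1 = 1)
    (i : I) {j : ℕ+} (a : A i) (s r : Σ i, A i)
    (L : List (Σ i, A i)) (hj : (j : ℕ) = L.length + 1) (hs : s.1 ≠ i) (hr : r.1 ≠ i)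
    (h0 : ψ r.1 r.2 = 0) : VacEq ψ (replica i j a * layerVec (s :: r :: L)) 0 := by
  have key : ∀ k ≤ L.length + 1, VacEq ψ (P A i k * layerVec (s :: r :: L)) 0 := fun k hk => by
    refine (P_mul_layerVec_cons hψ i s _ (by simp; omega) hs).trans ?_
    simpa using (P_mul_layerVec_cons_centered hψ i r L hk hr h0).smul (ψ s.1 s.2)
  rw [replica_apply, mul_assoc, sub_mul]
  simpa using ((key j (by omega)).sub (key (j - 1) (by omega))).mul_left
    (siteElt (i, j) (BoolExt.incl a))

theorem tensorFunctional_layerVec_singleton {ψ : ∀ i, A i →ₗ[ℂ] ℂ} (hψ : ∀ i, ψ i 1 = 1)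
    (s : Σ i, A i) :
    tensorFunctional ψ (layerVec [s]) = ψ s.1 s.2 := by
  classical
  have h1 := boolFunctional_incl (ψ s.1) (hψ s.1) s.2
  have hx : ∀ r : I × ℕ+, r ≠ (s.1, 1) → boolFunctional (ψ r.1)
      (Pi.mulSingle (M := fun s : I × ℕ+ => BoolExt (A s.1)) (s.1, 1) (BoolExt.incl s.2) r) = 1 :=
    fun r hr => by rw [Pi.mulSingle_eq_of_ne hr, boolFunctional_one _ (hψ _)]
  have hs : layerVec [s] = PiTensorProduct.tprod ℂ
      (Pi.mulSingle (M := fun s : I × ℕ+ => BoolExt (A s.1)) (s.1, 1) (BoolExt.incl s.2)) :=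
    mul_one _
  rw [hs, tensorFunctional, productFunctional, PiTensorProduct.lift.tprod]
  change (if _ then _ else _) = _
  rw [if_pos, finprod_eq_single _ (s.1, 1) hx, Pi.mulSingle_eq_same, h1]
  refine (Set.finite_singleton (s.1, (1 : ℕ+))).subset fun r hr => ?_
  by_contra h
  exact hr (hx r h)

end VacuumCalculus

/-! ### First order behaviour of deformations -/

section Deformation

variable {I : Type*} {A : I → Type*} [∀ i, Ring (A i)] [∀ i, Algebra ℂ (A i)]
  {φ : ∀ i, A i →ₗ[ℂ] ℂ} {N : ℕ}

/-- The little-o bound holds on a neighborhood of `0`, hence at `0` itself, where `t ^ N` vanishes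
because `N ≥ 1`. -/
theorem Deformation.functional_zero (D : Deformation φ N) (hN : 1 ≤ N) (i : I) (a : A i) :
    D.functional 0 i a = φ i a := by
  have h := (D.expansion i a).bound one_pos
  have h0 := h.self_of_nhds
  have hN' : N ≠ 0 := by omega
  have hsum : ∑ k ∈ Finset.Icc 1 N, (((0 : ℝ) : ℂ) ^ k / (k.factorial : ℂ)) * D.coeff k i a = 0 :=
    Finset.sum_eq_zero fun k hk => by
      have : k ≠ 0 := by have := Finset.mem_Icc.1 hk; omega
      simp [this]
  rw [hsum, zero_pow hN', norm_zero, mul_zero, add_zero] at h0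
  exact sub_eq_zero.1 (norm_le_zero_iff.1 h0)

theorem hasDerivAt_zero_ofReal_pow_div_factorial_mul (k : ℕ) (c : ℂ) (hk : 1 ≤ k) :
    HasDerivAt (fun t : ℝ => ((t : ℂ) ^ k / (k.factorial : ℂ)) * c) (if k = 1 then c else 0) 0 := by
  have h := (((hasDerivAt_id (0 : ℝ)).ofReal_comp.pow k).div_const
    (k.factorial : ℂ)).mul_const c
  refine h.congr_deriv ?_
  split_ifs with h1
  · subst h1; simp
  · have : k - 1 ≠ 0 := by omega
    simp [this]

/-- Since `N ≥ 1`, the error `o(t^N)` is also `o(t)`, and only the linear term of the polynomial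
contributes. -/
theorem Deformation.hasDerivAt (D : Deformation φ N) (hN : 1 ≤ N) (i : I) (a : A i) :
    HasDerivAt (fun t : ℝ => D.functional t i a) (D.coeff 1 i a) 0 := by
  have hpoly : HasDerivAt (fun t : ℝ => φ i a +
      ∑ k ∈ Finset.Icc 1 N, ((t : ℂ) ^ k / (k.factorial : ℂ)) * D.coeff k i a)
      (D.coeff 1 i a) 0 := by
    have h := (HasDerivAt.fun_sum (u := Finset.Icc 1 N) fun k hk =>
      hasDerivAt_zero_ofReal_pow_div_factorial_mul k (D.coeff k i a)
        (Finset.mem_Icc.1 hk).1).const_add (φ i a)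
    refine h.congr_deriv ?_
    rw [Finset.sum_ite_eq' (Finset.Icc 1 N) 1 fun k => D.coeff k i a,
      if_pos (Finset.mem_Icc.2 ⟨le_rfl, hN⟩)]
  have herr : HasDerivAt (fun t : ℝ => D.functional t i a - (φ i a +
      ∑ k ∈ Finset.Icc 1 N, ((t : ℂ) ^ k / (k.factorial : ℂ)) * D.coeff k i a)) 0 0 := by
    rw [hasDerivAt_iff_isLittleO]
    have hO : (fun t : ℝ => t ^ N) =O[𝓝 0] (fun t : ℝ => t) := by
      refine Asymptotics.IsBigO.of_bound 1 ?_
      filter_upwards [Metric.ball_mem_nhds (0 : ℝ) one_pos] with t ht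
      rw [mem_ball_zero_iff] at ht
      rw [norm_pow, one_mul]
      exact pow_le_of_le_one (norm_nonneg t) ht.le (by omega)
    refine ((D.expansion i a).trans_isBigO hO).congr (fun t => ?_) (fun t => by simp)
    have h0 : ∑ k ∈ Finset.Icc 1 N, (((0 : ℝ) : ℂ) ^ k / (k.factorial : ℂ)) * D.coeff k i a = 0 :=
      Finset.sum_eq_zero fun k hk => by
        have : k ≠ 0 := by have := Finset.mem_Icc.1 hk; omega
        simp [this]
    rw [h0, D.functional_zero hN]
    simp
  simpa using herr.fun_add hpoly

/-- A curve `x` in an algebra such that all `t ↦ F_t(b x(t))` are differentiable at `0`. -/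
def MomentDifferentiable {B : Type*} [Ring B] [Algebra ℂ B] (F : ℝ → B →ₗ[ℂ] ℂ) (x : ℝ → B) :
    Prop :=
  ∀ b, DifferentiableAt ℝ (fun t => F t (b * x t)) 0

namespace MomentDifferentiable

variable {B : Type*} [Ring B] [Algebra ℂ B] {F : ℝ → B →ₗ[ℂ] ℂ} {x : ℝ → B}

theorem differentiableAt (h : MomentDifferentiable F x) :
    DifferentiableAt ℝ (fun t => F t (x t)) 0 := by
  simpa using h 1

theorem const_mul (h : MomentDifferentiable F x) (a : B) :
    MomentDifferentiable F (fun t => a * x t) := fun b => by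
  simpa [mul_assoc] using h (b * a)

/-- The centering of a layer depends on `t`, so layers are curves rather than fixed elements.
Closure under centering and under left multiplication is what the moves require. -/
theorem sub_smul_one (h : MomentDifferentiable F x)
    (hF : ∀ b, DifferentiableAt ℝ (fun t => F t b) 0) :
    MomentDifferentiable F (fun t => x t - F t (x t) • 1) := fun b => by
  simpa [mul_sub] using (h b).fun_sub (h.differentiableAt.fun_mul (hF b))

end MomentDifferentiable

theorem Deformation.momentDifferentiable_const (D : Deformation φ N) (hN : 1 ≤ N) (i : I)
    (a : A i) : MomentDifferentiable (fun t => D.functional t i) (fun _ => a) :=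
  fun b => (D.hasDerivAt hN i (b * a)).differentiableAt

end Deformation

/-! ### Products of replicas along a word -/

section SuffixProducts

variable {I : Type*} {A : I → Type*} [∀ i, Ring (A i)] [∀ i, Algebra ℂ (A i)]
  {n : ℕ} (w : Fin n → ℕ+) (i : Fin n → I) (a : ∀ k, A (i k))

/-- The product of the replicas at the positions `≥ k`. -/
def suffixProd (k : ℕ) : TensorAlg A :=
  ((List.ofFn fun r => replica (i r) (w r) (a r)).drop k).prod

theorem suffixProd_eq_mul (k : Fin n) :
    suffixProd w i a k = replica (i k) (w k) (a k) * suffixProd w i a (k + 1) := by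
  rw [suffixProd, List.drop_eq_getElem_cons (by simp), List.prod_cons, List.getElem_ofFn, suffixProd]

theorem suffixProd_length : suffixProd w i a n = 1 := by
  rw [suffixProd, List.drop_of_length_le (by simp), List.prod_nil]

theorem motzkinFunctional_eq_suffixProd (ψ : ∀ i, A i →ₗ[ℂ] ℂ) :
    motzkinFunctional ψ w i a = tensorFunctional ψ (suffixProd w i a 0) := by
  simp [motzkinFunctional, suffixProd]

variable {w i a} {ψ : ∀ i, A i →ₗ[ℂ] ℂ}

theorem motzkinFunctional_eq_zero_of_vacEq (h : VacEq ψ (suffixProd w i a 0) 0) :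
    motzkinFunctional ψ w i a = 0 := by
  rw [motzkinFunctional_eq_suffixProd, h.value, map_zero]

theorem motzkinFunctional_eq_of_vacEq (hψ : ∀ i, ψ i 1 = 1) {c : ℂ} {s : Σ i, A i}
    (h : VacEq ψ (suffixProd w i a 0) (c • layerVec [s])) :
    motzkinFunctional ψ w i a = c * ψ s.1 s.2 := by
  rw [motzkinFunctional_eq_suffixProd, h.value, map_smul, tensorFunctional_layerVec_singleton hψ,
    smul_eq_mul]

theorem suffixProd_vacEq_last (hψ : ∀ i, ψ i 1 = 1) (k : Fin n) (hk : (k : ℕ) + 1 = n)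
    (hw : w k = 1) : VacEq ψ (suffixProd w i a k) (layerVec [⟨i k, a k⟩]) := by
  rw [suffixProd_eq_mul, hk, suffixProd_length]
  exact replica_mul_one_vacEq hψ (i k) (by rw [hw]; rfl) (a k)

end SuffixProducts

/-! ### Pyramid words -/

section Pyramid

variable {I : Type*} {A : I → Type*} [∀ i, Ring (A i)] [∀ i, Algebra ℂ (A i)]

theorem pairMoment_sub_smul_one (ψ : ∀ i, A i →ₗ[ℂ] ℂ) {i i' : I} (h : i' = i) (a : A i)
    (b : A i') (c : ℂ) :
    pairMoment ψ a (b - c • 1) = pairMoment ψ a b - c * ψ i a := by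
  subst h
  simp [pairMoment, mul_sub]

/-- The labels agree only propositionally, so the product is exposed through a `y` of known
expectation, avoiding transports. -/
theorem replica_mul_layerVec_down_pairMoment {ψ : ∀ i, A i →ₗ[ℂ] ℂ} (hψ : ∀ i, ψ i 1 = 1) (i : I)
    {j : ℕ+} (a : A i) (s r : Σ i, A i) (L : List (Σ i, A i)) (hj : (j : ℕ) = L.length + 1)
    (hs : s.1 ≠ i) (hr : r.1 = i) (hL : ∀ r ∈ L.head?, r.1 ≠ i ∧ ψ r.1 r.2 = 0) :
    ∃ y : A i, ψ i y = pairMoment ψ a r.2 ∧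
      VacEq ψ (replica i j a * layerVec (s :: r :: L)) (ψ s.1 s.2 • layerVec (⟨i, y⟩ :: L)) := by
  obtain ⟨l, x⟩ := r
  subst hr
  exact ⟨a * x, by simp [pairMoment], replica_mul_layerVec_down hψ _ a s x L hj hs hL⟩

variable {n : ℕ} (ψ : ∀ i, A i →ₗ[ℂ] ℂ) (i : Fin n → I) (a : ∀ k, A (i k))

/-- The centered variables at the positions `≥ k`, with their labels. -/
def centeredSuffix (k : ℕ) : List (Σ i, A i) :=
  (List.ofFn fun r => (⟨i r, a r - ψ (i r) (a r) • 1⟩ : Σ i, A i)).drop k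

theorem length_centeredSuffix (k : ℕ) : (centeredSuffix ψ i a k).length = n - k := by
  simp [centeredSuffix]

theorem centeredSuffix_eq_cons (k : Fin n) : centeredSuffix ψ i a k =
    ⟨i k, a k - ψ (i k) (a k) • 1⟩ :: centeredSuffix ψ i a (k + 1) := by
  rw [centeredSuffix, List.drop_eq_getElem_cons (by simp), List.getElem_ofFn, centeredSuffix]

variable {ψ i a}

theorem centeredSuffix_head (hψ : ∀ i, ψ i 1 = 1) (hi : Alternating i) (k : Fin n) :
    ∀ r ∈ (centeredSuffix ψ i a (k + 1)).head?, r.1 ≠ i k ∧ ψ r.1 r.2 = 0 := by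
  intro r hr
  by_cases hk : (k : ℕ) + 1 < n
  · rw [centeredSuffix_eq_cons ψ i a ⟨k + 1, hk⟩] at hr
    obtain rfl : _ = r := by simpa using hr
    exact ⟨(hi k ⟨k + 1, hk⟩ rfl).symm, by simp [hψ]⟩
  · rw [List.eq_nil_of_length_eq_zero (l := centeredSuffix ψ i a (k + 1))
      (by rw [length_centeredSuffix]; omega)] at hr
    simp at hr

/-- Read from right to left only upward moves occur, so every variable except the leftmost ends up
centered. -/
theorem suffixProd_vacEq_of_descending {w : Fin n → ℕ+} (hψ : ∀ i, ψ i 1 = 1)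
    (hi : Alternating i) (k : Fin n) (hw : ∀ r : Fin n, k ≤ r → (w r : ℕ) = n - r) :
    VacEq ψ (suffixProd w i a k) (layerVec (⟨i k, a k⟩ :: centeredSuffix ψ i a (k + 1))) := by
  obtain ⟨d, hd⟩ : ∃ d, (k : ℕ) + 1 + d = n := ⟨n - (k + 1), by omega⟩
  induction d generalizing k with
  | zero =>
    rw [List.eq_nil_of_length_eq_zero (l := centeredSuffix ψ i a (k + 1))
      (by rw [length_centeredSuffix]; omega)]
    refine suffixProd_vacEq_last hψ k (by omega) (PNat.eq ?_)
    rw [hw k le_rfl, PNat.one_coe]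
    omega
  | succ d ih =>
    have hk : (k : ℕ) + 1 < n := by omega
    rw [suffixProd_eq_mul, centeredSuffix_eq_cons ψ i a ⟨k + 1, hk⟩]
    refine ((ih ⟨k + 1, hk⟩ (fun r hr => hw r ?_) (by simp; omega)).mul_left _).trans
      (replica_mul_layerVec_up hψ (i k) (a k) ⟨_, _⟩ _ ?_ (hi k ⟨k + 1, hk⟩ rfl).symm)
    · exact le_trans (by rw [Fin.le_def]; simp) hr
    · rw [hw k le_rfl, length_centeredSuffix]
      simp only
      omega

/-- The part of the value of a pyramid moment contributed by the positions from `k` to the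
mirror image of `k`. -/
def pyramidValue (ψ : ∀ i, A i →ₗ[ℂ] ℂ) (i : Fin n → I) (a : ∀ k, A (i k)) (m k : ℕ) : ℂ :=
  ∏ r ∈ Finset.univ.filter (fun r : Fin n => k ≤ r ∧ (r : ℕ) + 1 < m),
    (pairMoment ψ (a r) (a r.rev) - ψ (i r.rev) (a r.rev) * ψ (i r) (a r))

theorem pyramidValue_eq_mul (m : ℕ) (k : Fin n) (hk : (k : ℕ) + 1 < m) :
    pyramidValue ψ i a m k =
      (pairMoment ψ (a k) (a k.rev) - ψ (i k.rev) (a k.rev) * ψ (i k) (a k)) *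
        pyramidValue ψ i a m (k + 1) := by
  have h : Finset.univ.filter (fun r : Fin n => (k : ℕ) ≤ r ∧ (r : ℕ) + 1 < m) =
      insert k (Finset.univ.filter (fun r : Fin n => (k : ℕ) + 1 ≤ r ∧ (r : ℕ) + 1 < m)) := by
    ext r
    simp only [Finset.mem_filter, Finset.mem_univ, true_and, Finset.mem_insert, Fin.ext_iff]
    omega
  rw [pyramidValue, h, Finset.prod_insert (by simp), pyramidValue]

theorem pyramidValue_eq_one {m k : ℕ} (hk : m ≤ k + 1) : pyramidValue ψ i a m k = 1 := by
  rw [pyramidValue, Finset.filter_eq_empty_iff.2, Finset.prod_empty]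
  intro r _
  omega

theorem IsPyramid.one_le {m : ℕ} {w : Fin n → ℕ+} (h : IsPyramid m w) : 1 ≤ m := h.1

theorem IsPyramid.length_eq {m : ℕ} {w : Fin n → ℕ+} (h : IsPyramid m w) : n = 2 * m - 1 := h.2.1

/-- Beyond the summit, each position `k` multiplies the centered variable at its mirror image,
contributing `ψ(a_k (a_{k.rev} - ψ(a_{k.rev}) 1))`, a covariance; if the two labels differ, the
vector is zero. The functional need not vanish on the variables, so the formula applies at every
small `t`. -/
theorem suffixProd_pyramid {w : Fin n → ℕ+} (hψ : ∀ i, ψ i 1 = 1) (hi : Alternating i) {m : ℕ}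
    (hw : IsPyramid m w) (top : Fin n) (htop : (top : ℕ) + 1 = m) (k : Fin n)
    (hk : (k : ℕ) + 1 ≤ m) :
    (VacEq ψ (suffixProd w i a k) 0 ∧ ∃ r : Fin n, i r ≠ i r.rev) ∨
      ∃ (y : A (i k)) (c : ℂ), VacEq ψ (suffixProd w i a k)
          (c • layerVec (⟨i k, y⟩ :: centeredSuffix ψ i a (n - k))) ∧
        c * ψ (i k) y = pyramidValue ψ i a m k * ψ (i top) (a top) ∧
        ∀ r : Fin n, k ≤ r → (r : ℕ) + 1 < m → i r = i r.rev := by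
  have hn := hw.length_eq
  obtain ⟨d, hd⟩ : ∃ d, (k : ℕ) + 1 + d = m := ⟨m - (k + 1), by omega⟩
  induction d generalizing k with
  | zero =>
    obtain rfl : k = top := Fin.ext (by omega)
    refine Or.inr ⟨a k, 1, ?_, ?_, fun r hr hr' => ?_⟩
    -- The summit is the middle position of a word of length `2m - 1`.
    · rw [one_smul, show n - (k : ℕ) = k + 1 by omega]
      refine suffixProd_vacEq_of_descending hψ hi k fun r hr => ?_
      rw [Fin.le_def] at hr
      rw [hw.2.2 r]
      split_ifs <;> omega
    · rw [pyramidValue_eq_one (by omega)]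
    · rw [Fin.le_def] at hr
      omega
  | succ d ih =>
    have hkn : (k : ℕ) + 1 < n := by omega
    rw [suffixProd_eq_mul]
    rcases ih ⟨k + 1, hkn⟩ (by simp; omega) (by simp; omega) with
      ⟨h0, r, hr⟩ | ⟨y, c, h, hval, hlab⟩
    · exact Or.inl ⟨by simpa using h0.mul_left (replica (i k) (w k) (a k)), r, hr⟩
    · have hs : i ⟨k + 1, hkn⟩ ≠ i k := (hi k ⟨k + 1, hkn⟩ rfl).symm
      have hcs := centeredSuffix_eq_cons ψ i a k.rev
      have hrev : ((k.rev : Fin n) : ℕ) = n - (k + 1) := Fin.val_rev k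
      have hwk : (w k : ℕ) = (centeredSuffix ψ i a (k.rev + 1)).length + 1 := by
        rw [hw.2.2 k, length_centeredSuffix, if_pos hk]
        omega
      have hhead := centeredSuffix_head (a := a) hψ hi k.rev
      rw [← hrev, hcs] at h
      have h' := h.mul_left (replica (i k) (w k) (a k))
      rw [mul_smul_comm] at h'
      by_cases hl : i k.rev = i k
      · rw [hl] at hhead
        obtain ⟨z, hz, hstep⟩ := replica_mul_layerVec_down_pairMoment hψ (i k) (a k) ⟨_, y⟩
          ⟨i k.rev, a k.rev - ψ (i k.rev) (a k.rev) • 1⟩ _ hwk hs hl hhead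
        refine Or.inr ⟨z, c * ψ _ y, ?_, ?_, ?_⟩
        · rw [show n - (k : ℕ) = k.rev + 1 by omega, mul_smul]
          exact h'.trans (hstep.smul c)
        · rw [hval, hz, pairMoment_sub_smul_one ψ hl, pyramidValue_eq_mul m k (by omega)]
          ring
        · intro r hr hr'
          by_cases hrk : r = k
          · rw [hrk, hl]
          · refine hlab r ?_ hr'
            rw [Fin.le_def] at hr ⊢
            rw [Fin.ext_iff] at hrk
            simp only
            omega
      · refine Or.inl ⟨h'.trans ?_, k, Ne.symm hl⟩
        simpa using (replica_mul_layerVec_down_eq_zero hψ (i k) (a k) ⟨_, y⟩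
          ⟨i k.rev, a k.rev - ψ (i k.rev) (a k.rev) • 1⟩ _ hwk hs hl (by simp [hψ])).smul c

theorem motzkinFunctional_pyramid {w : Fin n → ℕ+} (hψ : ∀ i, ψ i 1 = 1) (hi : Alternating i)
    {m : ℕ} (hw : IsPyramid m w) (top : Fin n) (htop : (top : ℕ) + 1 = m)
    (hlab : ∀ r, i r = i r.rev) :
    motzkinFunctional ψ w i a = pyramidValue ψ i a m 0 * ψ (i top) (a top) := by
  have hn := hw.length_eq
  have h1 := hw.one_le
  rcases suffixProd_pyramid (a := a) hψ hi hw top htop ⟨0, by omega⟩ (by simpa using h1) with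
    ⟨-, r, hr⟩ | ⟨y, c, h, hval, -⟩
  · exact absurd (hlab r) hr
  · rw [List.eq_nil_of_length_eq_zero (l := centeredSuffix ψ i a _)
      (by rw [length_centeredSuffix]; simp)] at h
    rw [motzkinFunctional_eq_of_vacEq hψ h, hval]

theorem motzkinFunctional_pyramid_eq_zero {w : Fin n → ℕ+} (hψ : ∀ i, ψ i 1 = 1)
    (hi : Alternating i) {m : ℕ} (hw : IsPyramid m w) (hlab : ¬ ∀ r, i r = i r.rev) :
    motzkinFunctional ψ w i a = 0 := by
  have hn := hw.length_eq
  have h1 := hw.one_le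
  rcases suffixProd_pyramid (a := a) hψ hi hw ⟨m - 1, by omega⟩ (by simp; omega) ⟨0, by omega⟩
    (by simpa using h1) with ⟨h0, -⟩ | ⟨y, c, -, -, h⟩
  · exact motzkinFunctional_eq_zero_of_vacEq h0
  -- The surviving branch gives label symmetry on the left half; the middle position is its own
  -- mirror image and the right half follows by reflection.
  · refine absurd (fun r => ?_) hlab
    have hr : ((r.rev : Fin n) : ℕ) = n - (r + 1) := Fin.val_rev r
    rcases lt_trichotomy ((r : ℕ) + 1) m with hlt | heq | hgt
    · exact h r (Nat.zero_le _) hlt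
    · rw [show r.rev = r from Fin.ext (by omega)]
    · have := h r.rev (Nat.zero_le _) (by omega)
      rw [this, Fin.rev_rev]

end Pyramid

/-! ### Level return partitions of pyramid words. -/

section PyramidAdapted

variable {n : ℕ} {w : Fin n → ℕ+} {I : Type*} {i : Fin n → I}

theorem IsPyramid.eq_or_eq_rev {m : ℕ} (hw : IsPyramid m w) {p q : Fin n} (h : w p = w q) :
    q = p ∨ q = p.rev := by
  have hp := hw.2.2 p
  have hq := hw.2.2 q
  have hn := hw.length_eq
  rw [h] at hp
  have hr : ((p.rev : Fin n) : ℕ) = n - (p + 1) := Fin.val_rev p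
  rw [Fin.ext_iff, Fin.ext_iff]
  split_ifs at hp hq <;> omega

theorem IsPyramid.w_rev {m : ℕ} (hw : IsPyramid m w) (p : Fin n) : w p.rev = w p := by
  have hp := hw.2.2 p
  have hq := hw.2.2 p.rev
  have hn := hw.length_eq
  have hr : ((p.rev : Fin n) : ℕ) = n - (p + 1) := Fin.val_rev p
  refine PNat.eq ?_
  split_ifs at hp hq <;> omega

/-- A pyramid visits each color exactly at a position and its mirror image, with larger colors in
between; at the summit the pair collapses to a singleton. -/
theorem IsPyramid.isBlock_pair {m : ℕ} (hw : IsPyramid m w) (p : Fin n) :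
    IsBlock w (w p) {p, p.rev} := by
  have hn := hw.length_eq
  have hr : ((p.rev : Fin n) : ℕ) = n - (p + 1) := Fin.val_rev p
  have hmem : ∀ r, w r = w p → r ∈ ({p, p.rev} : Finset (Fin n)) := fun r h => by
    simpa using hw.eq_or_eq_rev h.symm
  refine ⟨⟨⟨p, by simp⟩, ?_, fun _ _ _ _ r _ _ h => hmem r h, ?_, ?_⟩, fun V hV _ k hk =>
    hmem k (hV.color k hk)⟩
  · intro k hk
    rcases (by simpa using hk : k = p ∨ k = p.rev) with rfl | rfl
    · rfl
    · exact hw.w_rev p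
  · rintro q q' ⟨hq, hq', hlt, -⟩
    rw [Fin.lt_def] at hlt
    simp only [Finset.mem_insert, Finset.mem_singleton, Fin.ext_iff] at hq hq'
    omega
  · rintro q q' ⟨hq, hq', hlt, -⟩ r hr1 hr2
    rw [Fin.lt_def] at hlt hr1 hr2
    simp only [Finset.mem_insert, Finset.mem_singleton, Fin.ext_iff] at hq hq'
    rw [← PNat.coe_lt_coe, hw.2.2 p, hw.2.2 r]
    split_ifs <;> omega

/-- The nesting condition comes for free: positions of neighboring colors are adjacent up to
reflection, so alternation separates their labels. -/
theorem IsPyramid.isAdapted_iff {m : ℕ} (hw : IsPyramid m w) (hi : Alternating i) :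
    IsAdapted w i ↔ ∀ r, i r = i r.rev := by
  have hn := hw.length_eq
  constructor
  · intro h r
    exact h.uniform _ _ (hw.isBlock_pair r) r (by simp) r.rev (by simp)
  · intro h
    refine ⟨?_, ?_⟩
    · intro j V hV p hp q hq
      rcases hw.eq_or_eq_rev ((hV.prop.color p hp).trans (hV.prop.color q hq).symm) with rfl | rfl
      · rfl
      · exact h p
    · intro j V hV _ _ _ V' hV' _ r hr r' hr'
      have hc : (w r' : ℕ) = w r + 1 := by
        rw [hV.prop.color r hr, hV'.prop.color r' hr', PNat.add_coe, PNat.one_coe]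
      have hr1 := hw.2.2 r
      have hr2 := hw.2.2 r'
      have hrev : ((r.rev : Fin n) : ℕ) = n - (r + 1) := Fin.val_rev r
      by_cases h1 : (r' : ℕ) = r + 1
      · exact hi r r' h1
      by_cases h2 : (r : ℕ) = r' + 1
      · exact (hi r' r h2).symm
      rw [h r]
      by_cases h3 : (r' : ℕ) = r.rev + 1
      · exact hi r.rev r' h3
      · refine (hi r' r.rev ?_).symm
        split_ifs at hr1 hr2 <;> omega

end PyramidAdapted

/-! ### Words other than pyramids -/

section NonPyramid

variable {I : Type*} {A : I → Type*} [∀ i, Ring (A i)] [∀ i, Algebra ℂ (A i)]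
  {φ : ∀ i, A i →ₗ[ℂ] ℂ} {N : ℕ} {n : ℕ}

theorem hasDerivAt_mul_of_zero_of_zero {c v : ℝ → ℂ} (hc : DifferentiableAt ℝ c 0)
    (hv : DifferentiableAt ℝ v 0) (hc0 : c 0 = 0) (hv0 : v 0 = 0) :
    HasDerivAt (fun t => c t * v t) 0 0 := by
  simpa [hc0, hv0] using hc.hasDerivAt.fun_mul hv.hasDerivAt

theorem hasDerivAt_mul_of_hasDerivAt_zero {c v : ℝ → ℂ} (hc : HasDerivAt c 0 0)
    (hv : DifferentiableAt ℝ v 0) (hc0 : c 0 = 0) : HasDerivAt (fun t => c t * v t) 0 0 := by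
  simpa [hc0] using hc.fun_mul hv.hasDerivAt

/-- From the position `k` on, `w` descends by steps of `1` after having possibly ascended by steps
of `1` to the height `m`. -/
def IsPyramidSuffix (w : Fin n → ℕ+) (m : ℕ) (k : Fin n) : Prop :=
  ∀ r : Fin n, k ≤ r → (w r : ℕ) = if n ≤ r + m then n - r else r + 2 * m - n

/-- The vanishing behaviour at `t = 0` of the prefactor `c(t)` and of the expectation `v(t)` of the
top layer, in the reduction of the product of the replicas at the positions `≥ k`. -/
def OrderBound (w : Fin n → ℕ+) (k : Fin n) (c v : ℝ → ℂ) : Prop :=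
  (IsPyramidSuffix w (n - k) k ∧ v 0 = 0) ∨
  (c 0 = 0 ∧ (∃ m, k + m ≤ n ∧ IsPyramidSuffix w m k)) ∨
  (c 0 = 0 ∧ v 0 = 0) ∨ (c 0 = 0 ∧ HasDerivAt c 0 0)

/-- The four cases are: still climbing to the summit; past the summit of a pyramid, one zero having
been split off; off the pyramid with a zero in both the prefactor and the top layer; off the pyramid
with a double zero in the prefactor. In the last two, the product has a double zero. -/
theorem OrderBound.mul_eq_zero {w : Fin n → ℕ+} {k : Fin n} {c v : ℝ → ℂ}
    (h : OrderBound w k c v) : c 0 * v 0 = 0 := by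
  rcases h with ⟨-, h⟩ | ⟨h, -⟩ | ⟨h, -⟩ | ⟨h, -⟩ <;> simp [h]

theorem IsPyramidSuffix.extend {w : Fin n → ℕ+} {m : ℕ} {k k' : Fin n}
    (h : IsPyramidSuffix w m k) (hk : (k : ℕ) = k' + 1)
    (hw : (w k' : ℕ) = if n ≤ k' + m then n - k' else k' + 2 * m - n) :
    IsPyramidSuffix w m k' := by
  intro r hr
  by_cases hrk : r = k'
  · rw [hrk, hw]
  · refine h r ?_
    rw [Fin.le_def] at hr ⊢
    rw [Fin.ext_iff] at hrk
    omega

theorem IsPyramidSuffix.raise {w : Fin n → ℕ+} {k k' : Fin n}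
    (h : IsPyramidSuffix w (n - k) k) (hk : (k : ℕ) = k' + 1) (hw : (w k' : ℕ) = n - k') :
    IsPyramidSuffix w (n - k') k' := by
  intro r hr
  rw [Fin.le_def] at hr
  rw [if_pos (by omega)]
  by_cases hrk : r = k'
  · rw [hrk, hw]
  · rw [Fin.ext_iff] at hrk
    rw [h r (by rw [Fin.le_def]; omega), if_pos (by omega)]

/-- The initial color `1` forces the length to be `2m - 1`. -/
theorem IsPyramidSuffix.isPyramid {w : Fin n → ℕ+} (hw : IsReducedMotzkin w) {m : ℕ}
    (hm : m ≤ n) (h : IsPyramidSuffix w m ⟨0, hw.pos⟩) : IsPyramid m w := by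
  have h1 : ∀ r, (w r : ℕ) = if n ≤ r + m then n - r else r + 2 * m - n :=
    fun r => h r (Nat.zero_le _)
  have h0 := h1 ⟨0, hw.pos⟩
  rw [hw.first _ rfl] at h0
  simp only [PNat.one_coe] at h0
  have hpos := hw.pos
  have hn : 1 ≤ m ∧ n = 2 * m - 1 := by split_ifs at h0 <;> omega
  refine ⟨hn.1, hn.2, fun k => ?_⟩
  rw [h1 k]
  split_ifs <;> omega

/-! ### Reduction of suffix products along a deformation. -/

variable (D : Deformation φ N)

/-- The evaluation at time `t` of a list of curves. -/
def evalLayers (t : ℝ) (L : List (Σ i, ℝ → A i)) : List (Σ i, A i) :=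
  L.map fun s => ⟨s.1, s.2 t⟩

/-- The product of the replicas at the positions `≥ k` acts on the vacuum as a multiple of a
layered vector with top layer of label `i_k` and centered lower layers. -/
structure Reduction (w : Fin n → ℕ+) (i : Fin n → I) (a : ∀ k, A (i k)) (k : Fin n)
    (c : ℝ → ℂ) (x : ℝ → A (i k)) (L : List (Σ i, ℝ → A i)) : Prop where
  vacEq : ∀ t ∈ Set.Ioo (-D.ε) D.ε, VacEq (D.functional t) (suffixProd w i a k)
    (c t • layerVec (⟨i k, x t⟩ :: evalLayers t L))
  length : (w k : ℕ) = L.length + 1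
  chain : (i k :: L.map Sigma.fst).IsChain (· ≠ ·)
  centered : ∀ s ∈ L, ∀ t ∈ Set.Ioo (-D.ε) D.ε, D.functional t s.1 (s.2 t) = 0
  layers : ∀ s ∈ L, MomentDifferentiable (fun t => D.functional t s.1) s.2
  top : MomentDifferentiable (fun t => D.functional t (i k)) x
  coeff : DifferentiableAt ℝ c 0
  order : OrderBound w k c (fun t => D.functional t (i k) (x t))

variable {D} {w : Fin n → ℕ+} {i : Fin n → I} {a : ∀ k, A (i k)} {k k' : Fin n}
  {c : ℝ → ℂ} {x : ℝ → A (i k)} {L : List (Σ i, ℝ → A i)}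

theorem Reduction.differentiableAt_mul (h : Reduction D w i a k c x L) :
    DifferentiableAt ℝ (fun t => c t * D.functional t (i k) (x t)) 0 :=
  h.coeff.fun_mul h.top.differentiableAt

theorem suffixProd_eq_replica_mul (hk : (k : ℕ) = k' + 1) :
    suffixProd w i a k' = replica (i k') (w k') (a k') * suffixProd w i a k := by
  rw [suffixProd_eq_mul, hk]

/-- The prefactor is unchanged and the new top has mean zero at `t = 0`. Pure climbing persists; any
other case has `c 0 = 0` and so acquires a zero in both factors. -/
theorem Reduction.up (h : Reduction D w i a k c x L) (hN : 1 ≤ N)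
    (ha : ∀ k, φ (i k) (a k) = 0) (hk : (k : ℕ) = k' + 1) (hi : i k' ≠ i k)
    (hw : (w k' : ℕ) = w k + 1) :
    Reduction D w i a k' c (fun _ => a k')
      (⟨i k, fun t => x t - D.functional t (i k) (x t) • 1⟩ :: L) where
  vacEq t ht := by
    rw [suffixProd_eq_replica_mul hk]
    refine ((h.vacEq t ht).mul_left _).trans ?_
    rw [mul_smul_comm]
    exact VacEq.smul (replica_mul_layerVec_up (D.functional_one t ht) (i k') (a k') ⟨i k, x t⟩ _
      (by rw [hw, h.length, evalLayers, List.length_map]) hi.symm) _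
  length := by rw [hw, h.length, List.length_cons]
  chain := List.IsChain.cons_cons hi h.chain
  centered s hs t ht := by
    rcases List.mem_cons.1 hs with rfl | hs
    · simp [D.functional_one t ht]
    · exact h.centered s hs t ht
  layers s hs := by
    rcases List.mem_cons.1 hs with rfl | hs
    · exact h.top.sub_smul_one fun b => (D.hasDerivAt hN _ b).differentiableAt
    · exact h.layers s hs
  top := D.momentDifferentiable_const hN _ _
  coeff := h.coeff
  order := by
    have hv : D.functional 0 (i k') (a k') = 0 := by rw [D.functional_zero hN, ha]
    rcases h.order with ⟨h1, -⟩ | ⟨h1, -⟩ | ⟨h1, -⟩ | ⟨h1, -⟩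
    · refine Or.inl ⟨h1.raise hk ?_, hv⟩
      have := h1 k le_rfl
      rw [if_pos (by omega)] at this
      omega
    all_goals exact Or.inr (Or.inr (Or.inl ⟨h1, hv⟩))

theorem Reduction.evalLayers_head (h : Reduction D w i a k c x L) {l : I}
    (hl : ∀ s ∈ L.head?, s.1 ≠ l) {t : ℝ} (ht : t ∈ Set.Ioo (-D.ε) D.ε) :
    ∀ r ∈ (evalLayers t L).head?, r.1 ≠ l ∧ D.functional t r.1 r.2 = 0 := by
  intro r hr
  rw [evalLayers, List.head?_map, Option.mem_map] at hr
  obtain ⟨s, hs, rfl⟩ := hr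
  exact ⟨hl s hs, h.centered s (List.mem_of_mem_head? hs) t ht⟩

/-- The word leaves the pyramid shape: the new prefactor `c v` vanishes at `0` in every case, and so
does the mean of the new top. -/
theorem Reduction.flat (h : Reduction D w i a k c x L) (hN : 1 ≤ N)
    (ha : ∀ k, φ (i k) (a k) = 0) (hk : (k : ℕ) = k' + 1) (hi : i k' ≠ i k)
    (hw : (w k' : ℕ) = w k) (hL : ∀ s ∈ L.head?, s.1 ≠ i k') :
    Reduction D w i a k' (fun t => c t * D.functional t (i k) (x t)) (fun _ => a k') L where
  vacEq t ht := by
    rw [suffixProd_eq_replica_mul hk, mul_smul]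
    refine ((h.vacEq t ht).mul_left _).trans ?_
    rw [mul_smul_comm]
    exact VacEq.smul (replica_mul_layerVec_flat (D.functional_one t ht) (i k') (a k') ⟨i k, x t⟩ _
      (by rw [hw, h.length, evalLayers, List.length_map]) hi.symm (h.evalLayers_head hL ht)) _
  length := by rw [hw, h.length]
  chain := by
    have := h.chain
    rw [List.isChain_cons] at this ⊢
    refine ⟨fun l hl => ?_, this.2⟩
    rw [List.head?_map, Option.mem_map] at hl
    obtain ⟨s, hs, rfl⟩ := hl
    exact (hL s hs).symm
  centered := h.centered
  layers := h.layers
  top := D.momentDifferentiable_const hN _ _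
  coeff := h.differentiableAt_mul
  order := Or.inr (Or.inr (Or.inl ⟨h.order.mul_eq_zero, (D.functional_zero hN _ _).trans (ha _)⟩))

/-- The top is now an old layer multiplied by `a k'`, with no reason for its mean to vanish. The
first descent splits off one zero, later descents of a pyramid keep it, and simultaneous zeros of
`c` and `v` merge into a double zero. -/
theorem Reduction.down {y : ℝ → A (i k')} (h : Reduction D w i a k c x (⟨i k', y⟩ :: L))
    (hk : (k : ℕ) = k' + 1) (hw : (w k : ℕ) = w k' + 1) :
    Reduction D w i a k' (fun t => c t * D.functional t (i k) (x t)) (fun t => a k' * y t) L where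
  vacEq t ht := by
    have hlen := h.length
    rw [List.length_cons, hw] at hlen
    -- Neighboring layers carry different labels, so the layer below the one being multiplied is
    -- foreign to `i k'`, as the downward move requires.
    have hch := h.chain
    rw [List.map_cons, List.isChain_cons_cons, List.isChain_cons] at hch
    have hhead : ∀ r ∈ (evalLayers t L).head?, r.1 ≠ i k' ∧ D.functional t r.1 r.2 = 0 := by
      intro r hr
      rw [evalLayers, List.head?_map, Option.mem_map] at hr
      obtain ⟨s, hs, rfl⟩ := hr
      refine ⟨(hch.2.1 s.1 ?_).symm, h.centered s
        (List.mem_cons_of_mem _ (List.mem_of_mem_head? hs)) t ht⟩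
      rw [List.head?_map, Option.mem_map]
      exact ⟨s, hs, rfl⟩
    rw [suffixProd_eq_replica_mul hk, mul_smul]
    refine ((h.vacEq t ht).mul_left _).trans ?_
    rw [mul_smul_comm]
    exact VacEq.smul (replica_mul_layerVec_down (D.functional_one t ht) (i k') (a k') ⟨i k, x t⟩
      (y t) _ (by rw [evalLayers, List.length_map]; omega) hch.1 hhead) _
  length := by
    have := h.length
    rw [List.length_cons] at this
    omega
  chain := (List.isChain_cons_cons.1 h.chain).2
  centered s hs := h.centered s (List.mem_cons_of_mem _ hs)
  layers s hs := h.layers s (List.mem_cons_of_mem _ hs)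
  top := (h.layers _ List.mem_cons_self).const_mul _
  coeff := h.differentiableAt_mul
  order := by
    have hv := h.top.differentiableAt
    have hwk := (w k').pos
    rcases h.order with ⟨h1, h2⟩ | ⟨h1, m, hm, h2⟩ | ⟨h1, h2⟩ | ⟨h1, h2⟩
    · refine Or.inr (Or.inl ⟨h.order.mul_eq_zero, n - k, by omega, h1.extend hk ?_⟩)
      have := h1 k le_rfl
      rw [if_pos (by omega)] at this
      rw [if_neg (by omega)]
      omega
    · refine Or.inr (Or.inl ⟨h.order.mul_eq_zero, m, by omega, h2.extend hk ?_⟩)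
      have := h2 k le_rfl
      rw [if_neg (by omega)]
      split_ifs at this <;> omega
    · exact Or.inr (Or.inr (Or.inr ⟨h.order.mul_eq_zero,
        hasDerivAt_mul_of_zero_of_zero h.coeff hv h1 h2⟩))
    · exact Or.inr (Or.inr (Or.inr ⟨h.order.mul_eq_zero,
        hasDerivAt_mul_of_hasDerivAt_zero h2 hv h1⟩))

theorem reduction_last (D : Deformation φ N) (hN : 1 ≤ N) (ha : ∀ k, φ (i k) (a k) = 0)
    (hw : w k = 1) (hk : (k : ℕ) + 1 = n) :
    Reduction D w i a k (fun _ => 1) (fun _ => a k) [] where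
  vacEq t ht := by
    rw [one_smul]
    exact suffixProd_vacEq_last (D.functional_one t ht) k hk hw
  length := by rw [hw]; rfl
  chain := List.isChain_singleton _
  centered s hs := by simp at hs
  layers s hs := by simp at hs
  top := D.momentDifferentiable_const hN _ _
  coeff := differentiableAt_const _
  order := by
    refine Or.inl ⟨fun r hr => ?_, (D.functional_zero hN _ _).trans (ha _)⟩
    obtain rfl : r = k := by
      rw [Fin.le_def] at hr
      exact Fin.ext (by omega)
    rw [hw, if_pos (by omega), PNat.one_coe]
    omega

/-- The first alternative arises when a flat step finds its own label below the top, or a downward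
step a foreign one; it persists under left multiplication. -/
theorem exists_reduction (D : Deformation φ N) (hN : 1 ≤ N) (hi : Alternating i)
    (ha : ∀ k, φ (i k) (a k) = 0) (hw : IsReducedMotzkin w) (k : Fin n) :
    (∀ t ∈ Set.Ioo (-D.ε) D.ε, VacEq (D.functional t) (suffixProd w i a k) 0) ∨
      ∃ c x L, Reduction D w i a k c x L := by
  obtain ⟨d, hd⟩ : ∃ d, (k : ℕ) + 1 + d = n := ⟨n - (k + 1), by omega⟩
  induction d generalizing k with
  | zero => exact Or.inr ⟨_, _, _, reduction_last D hN ha (hw.last k hd) hd⟩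
  | succ d ih =>
    obtain ⟨l, hl⟩ : ∃ l : Fin n, (l : ℕ) = k + 1 := ⟨⟨k + 1, by omega⟩, rfl⟩
    have hil : i k ≠ i l := hi k l hl
    rcases ih l (by omega) with h0 | ⟨c, x, L, h⟩
    · left
      intro t ht
      rw [suffixProd_eq_replica_mul hl]
      simpa using (h0 t ht).mul_left (replica (i k) (w k) (a k))
    · have hstep := hw.step k l hl
      have hlen := h.length
      simp only [Set.mem_insert_iff, Set.mem_singleton_iff] at hstep
      rcases hstep with hs | hs | hs
      · exact Or.inr ⟨_, _, _, h.up hN ha hl hil (by omega)⟩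
      · have hwk : (w k : ℕ) = w l := by omega
        by_cases hL : ∀ s ∈ L.head?, s.1 ≠ i k
        · exact Or.inr ⟨_, _, _, h.flat hN ha hl hil hwk hL⟩
        · left
          intro t ht
          rcases L with - | ⟨⟨l', y⟩, L⟩
          · simp at hL
          · obtain rfl : l' = i k := by simpa using hL
            rw [suffixProd_eq_replica_mul hl]
            refine ((h.vacEq t ht).mul_left _).trans ?_
            rw [mul_smul_comm]
            simpa [evalLayers] using (replica_mul_layerVec_flat_eq_zero (D.functional_one t ht) (i k) (a k)
              ⟨i l, x t⟩ (y t) (evalLayers t L)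
              (by rw [hwk, hlen, evalLayers, List.length_map, List.length_cons]) hil.symm).smul
              (c t)
      · rcases L with - | ⟨⟨l', y⟩, L⟩
        -- Descending from a single layer would require the color `0`.
        · have := (w k).pos
          rw [List.length_nil] at hlen
          omega
        · by_cases hl' : l' = i k
          · subst hl'
            exact Or.inr ⟨_, _, _, h.down hl (by omega)⟩
          · left
            intro t ht
            rw [suffixProd_eq_replica_mul hl]
            refine ((h.vacEq t ht).mul_left _).trans ?_
            rw [mul_smul_comm]
            rw [List.length_cons] at hlen
            simpa [evalLayers] using (replica_mul_layerVec_down_eq_zero (D.functional_one t ht) (i k) (a k)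
              ⟨i l, x t⟩ ⟨l', y t⟩ (evalLayers t L)
              (by rw [evalLayers, List.length_map]; omega) hil.symm hl'
              (h.centered _ List.mem_cons_self t ht)).smul (c t)

/-! ### Derivatives of the Motzkin functionals at `t = 0`. -/

theorem Deformation.Ioo_mem_nhds (D : Deformation φ N) : Set.Ioo (-D.ε) D.ε ∈ 𝓝 (0 : ℝ) :=
  _root_.Ioo_mem_nhds (neg_lt_zero.2 D.ε_pos) D.ε_pos

/-- At the first position the color is `1`, so a single layer is left and the moment is `c v`. The
two pyramid cases of `OrderBound` are excluded, and the other two give a double zero. -/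
theorem Deformation.hasDerivAt_motzkin_of_not_isPyramid (D : Deformation φ N) (hN : 1 ≤ N)
    (hi : Alternating i) (ha : ∀ k, φ (i k) (a k) = 0) (hw : IsReducedMotzkin w)
    (hp : ¬ ∃ m, IsPyramid m w) : HasDerivAt (fun t => D.motzkin w i t a) 0 0 := by
  rcases exists_reduction D hN hi ha hw ⟨0, hw.pos⟩ with h0 | ⟨c, x, L, h⟩
  · refine (hasDerivAt_const (0 : ℝ) (0 : ℂ)).congr_of_eventuallyEq ?_
    filter_upwards [D.Ioo_mem_nhds] with t ht
    exact motzkinFunctional_eq_zero_of_vacEq (h0 t ht)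
  · have hL : L = [] := by
      have := h.length
      rw [hw.first _ rfl, PNat.one_coe] at this
      exact List.eq_nil_of_length_eq_zero (by omega)
    subst hL
    refine HasDerivAt.congr_of_eventuallyEq
      (f := fun t => c t * D.functional t (i ⟨0, hw.pos⟩) (x t)) ?_ ?_
    · rcases h.order with ⟨h1, -⟩ | ⟨-, m, hm, h1⟩ | ⟨h1, h2⟩ | ⟨h1, h2⟩
      · exact absurd ⟨_, h1.isPyramid hw (by omega)⟩ hp
      · exact absurd ⟨_, h1.isPyramid hw (by simpa using hm)⟩ hp
      · exact hasDerivAt_mul_of_zero_of_zero h.coeff h.top.differentiableAt h1 h2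
      · exact hasDerivAt_mul_of_hasDerivAt_zero h2 h.top.differentiableAt h1
    · filter_upwards [D.Ioo_mem_nhds] with t ht
      exact motzkinFunctional_eq_of_vacEq (D.functional_one t ht) (h.vacEq t ht)

theorem Deformation.differentiableAt_pairMoment (D : Deformation φ N) (hN : 1 ≤ N) {l l' : I}
    (b : A l) (b' : A l') : DifferentiableAt ℝ (fun t => pairMoment (D.functional t) b b') 0 := by
  by_cases h : l' = l
  · subst h
    simpa [pairMoment] using (D.hasDerivAt hN _ (b * b')).differentiableAt
  · simp [pairMoment, h]

/-- In the product rule the term differentiating the covariances carries the factor `φ(a_top) = 0`;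
in the other, the covariances at `t = 0` reduce to pair moments because the means vanish. -/
theorem Deformation.hasDerivAt_motzkin_pyramid (D : Deformation φ N) (hN : 1 ≤ N)
    (hi : Alternating i) (ha : ∀ k, φ (i k) (a k) = 0) {m : ℕ} (hw : IsPyramid m w)
    (hlab : ∀ r, i r = i r.rev) (top : Fin n) (htop : (top : ℕ) + 1 = m) :
    HasDerivAt (fun t => D.motzkin w i t a)
      ((∏ k ∈ Finset.univ.filter (fun k : Fin n => (k : ℕ) + 1 < m),
        pairMoment φ (a k) (a k.rev)) * D.coeff 1 (i top) (a top)) 0 := by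
  have hzero : D.functional 0 = φ := by
    funext l
    exact LinearMap.ext fun b => D.functional_zero hN l b
  have hval : pyramidValue (D.functional 0) i a m 0 =
      ∏ k ∈ Finset.univ.filter (fun k : Fin n => (k : ℕ) + 1 < m),
        pairMoment φ (a k) (a k.rev) := by
    simp [hzero, pyramidValue, ha]
  have hd : DifferentiableAt ℝ (fun t => pyramidValue (D.functional t) i a m 0) 0 := by
    unfold pyramidValue
    exact DifferentiableAt.fun_finsetProd fun r _ => (D.differentiableAt_pairMoment hN _ _).fun_sub
      ((D.hasDerivAt hN _ _).differentiableAt.fun_mul (D.hasDerivAt hN _ _).differentiableAt)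
  refine HasDerivAt.congr_of_eventuallyEq
    (f := fun t => pyramidValue (D.functional t) i a m 0 * D.functional t (i top) (a top)) ?_ ?_
  · refine (hd.hasDerivAt.fun_mul (D.hasDerivAt hN (i top) (a top))).congr_deriv ?_
    rw [hval, hzero, ha, mul_zero, zero_add]
  · filter_upwards [D.Ioo_mem_nhds] with t ht
    exact motzkinFunctional_pyramid (D.functional_one t ht) hi hw top htop hlab

theorem Deformation.hasDerivAt_motzkin_pyramid_of_not_isAdapted (D : Deformation φ N)
    (hi : Alternating i) {m : ℕ} (hw : IsPyramid m w) (hlab : ¬ ∀ r, i r = i r.rev) :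
    HasDerivAt (fun t => D.motzkin w i t a) 0 0 := by
  refine (hasDerivAt_const (0 : ℝ) (0 : ℂ)).congr_of_eventuallyEq ?_
  filter_upwards [D.Ioo_mem_nhds] with t ht
  exact motzkinFunctional_pyramid_eq_zero (D.functional_one t ht) hi hw hlab

end NonPyramid

end InfMotzkin

end

theorem lemma7p2 {I : Type*} {A : I → Type*} [∀ i, Ring (A i)] [∀ i, Algebra ℂ (A i)]
    (φ : ∀ i, A i →ₗ[ℂ] ℂ) (hφ : ∀ i, φ i 1 = 1)
    (N : ℕ) (hN : 1 ≤ N) (D : InfMotzkin.Deformation φ N)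
    (n : ℕ) (i : Fin n → I) (hi : InfMotzkin.Alternating i)
    (a : ∀ k, A (i k)) (ha : ∀ k, φ (i k) (a k) = 0)
    (w : Fin n → ℕ+) (hw : InfMotzkin.IsReducedMotzkin w) :
    DifferentiableAt ℝ (fun t : ℝ => D.motzkin w i t a) 0 ∧
    (∀ m (hm : 1 ≤ m) (hn : n = 2 * m - 1), InfMotzkin.IsPyramid m w → InfMotzkin.IsAdapted w i →
      D.infMotzkin w i a =
        (∏ k ∈ Finset.univ.filter (fun k : Fin n => (k : ℕ) + 1 < m), InfMotzkin.pairMoment φ (a k) (a k.rev)) *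
          D.coeff 1 (i ⟨m - 1, by omega⟩) (a ⟨m - 1, by omega⟩)) ∧
    (¬ ((∃ m, InfMotzkin.IsPyramid m w) ∧ InfMotzkin.IsAdapted w i) →
      D.infMotzkin w i a = 0) := by
  have hmain : ∀ m (hm : 1 ≤ m) (hn : n = 2 * m - 1), InfMotzkin.IsPyramid m w →
      InfMotzkin.IsAdapted w i → HasDerivAt (fun t : ℝ => D.motzkin w i t a)
        ((∏ k ∈ Finset.univ.filter (fun k : Fin n => (k : ℕ) + 1 < m),
          InfMotzkin.pairMoment φ (a k) (a k.rev)) *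
            D.coeff 1 (i ⟨m - 1, by omega⟩) (a ⟨m - 1, by omega⟩)) 0 :=
    fun m hm hn hp had => D.hasDerivAt_motzkin_pyramid hN hi ha hp ((hp.isAdapted_iff hi).1 had)
      ⟨m - 1, by omega⟩ (Nat.sub_add_cancel hm)
  have hzero : ¬ ((∃ m, InfMotzkin.IsPyramid m w) ∧ InfMotzkin.IsAdapted w i) →
      HasDerivAt (fun t : ℝ => D.motzkin w i t a) 0 0 := fun h => by
    by_cases hp : ∃ m, InfMotzkin.IsPyramid m w
    · obtain ⟨m, hp⟩ := hp
      exact D.hasDerivAt_motzkin_pyramid_of_not_isAdapted hi hp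
        fun hlab => h ⟨⟨m, hp⟩, (hp.isAdapted_iff hi).2 hlab⟩
    · exact D.hasDerivAt_motzkin_of_not_isPyramid hN hi ha hw hp
  refine ⟨?_, fun m hm hn hp had => (hmain m hm hn hp had).deriv, fun h => (hzero h).deriv⟩
  by_cases h : (∃ m, InfMotzkin.IsPyramid m w) ∧ InfMotzkin.IsAdapted w i
  · obtain ⟨⟨m, hp⟩, had⟩ := h
    exact (hmain m hp.one_le hp.length_eq hp had).differentiableAt
  · exact (hzero h).differentiableAt
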